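/- Let $k$ be a field. Let $F$ be an oriented compact surface, possibly with boundary, let $\pi=H_1(F;\mathbf F_2)$, and let $X=K(\pi,1)$ be a CW complex with base point $x_0$ and a fixed identification $\pi_1(X,x_0)=\pi$. Let $(A,\tau)$ be an unoriented $(1+1)$-dimensional homotopy quantum field theory (HQFT) over $k$ with target $X$, in the sense of Turaev: it assigns a finite-dimensional $k$-vector space $A(M)$ to every closed $1$-manifold $M$ with one base point on each component and a map to $X$ sending the base points to $x_0$, an isomorphism to every homeomorphism of such manifolds respecting base points and maps, and a linear map $\tau(W)\colon A(M_0)\to A(M_1)$ to every compact surface $W$ with a map to $X$ and boundary $M_0\sqcup M_1$; it is natural under homeomorphisms, takes disjoint unions to tensor products (coherently, with $A(\emptyset)=k$) and gluings to compositions, takes cylinders $M\times[0,1]$ whose map is constant on $\{m\}\times[0,1]$ for all base points $m$ to identities, and depends on the map $W\to X$ only up to homotopy relative to $\partial W$. Assume that $(A,\tau)$ respects the S, T and 4-Tu relations: a sphere evaluates to $0$, a torus to $2$, and for four circles the surfaces $W_{ij}$ consisting of a tube joining the circles $i,j$ and discs bounding the other two satisfy $\tau(W_{12})+\tau(W_{34})=\tau(W_{13})+\tau(W_{24})$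 (all with trivial map to $X$). Let $D$ be an oriented link diagram on $F$ with $n$ ordered crossings, of which $n_-(D)$ are negative. For $\varepsilon\in\{0,1\}^n$ let $D_\varepsilon\subset F$ be the collection of circles obtained by $\varepsilon_j$-smoothing the $j$-th crossing for every $j$, where, for a crossing drawn with over strand $/$, the $0$-smoothing is $)($ and the $1$-smoothing is $\asymp$. Fix a map $h\colon F\to X$ which sends every loop to its class in $H_1(F;\mathbf F_2)=\pi_1(X)$, and on every circle of every $D_\varepsilon$ a base point which $h$ sends to $x_0$; so each $D_\varepsilon$ is a manifold over $X$ whose circles are labelled by their homology classes. If $\varepsilon'$ is obtained from $\varepsilon$ by changing the $j$-th entry from $0$ to $1$, let $\Sigma_{\varepsilon\to\varepsilon'}\subset F\times[0,1]$ be the surface from $D_\varepsilon$ to $D_{\varepsilon'}$ which is a saddle near the $j$-th crossing and $D_\varepsilon\times[0,1]$ elsewhere, mapped to $X$ by the projection to $F$ followed by $h$. Put $$C^i_{(A,\tau)}(F,D)=\bigoplus_{|\varepsilon|=i+n_-(D)}A(D_\varepsilon),\qquad |\varepsilon|=\sum_j\varepsilon_j ,$$ let $d^i\colon C^i_{(A,\tau)}(F,D)\to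 C^{i+1}_{(A,\tau)}(F,D)$ have the entries $(-1)^{l(\varepsilon,\varepsilon')}\tau(\Sigma_{\varepsilon\to\varepsilon'})$, where $l(\varepsilon,\varepsilon')$ is the number of $1$'s of $\varepsilon$ in front of the changed entry, and let $H^i_{(A,\tau)}(F,D)=\ker d^i/\operatorname{im}d^{i-1}$. Let $D^!$ be the diagram obtained from $D$ by changing all crossings. Then, for every choice of base points for $D$ and for $D^!$ and for every $i\in\mathbf Z$, there is an isomorphism of $k$-vector spaces $$H^{i}_{(A,\tau)}(F,D)\cong H^{-i}_{(A,\tau)}(F,D^!).$$ -/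

import Mathlib

open scoped TensorProduct NNReal unitInterval Topology

noncomputable section

namespace LinkHQFT

/-! ### Pointed one-manifolds and surface cobordisms over a target space -/

/-- `B` is the boundary of the topological surface with boundary `W`: every point has a chart onto
an open subset of the half plane `ℝ × [0, ∞)` in which `B` is the edge. -/
def IsSurfaceWithBoundary (W : Type) [TopologicalSpace W] (B : Set W) : Prop :=
  ∀ p : W, ∃ e : OpenPartialHomeomorph W (ℝ × ℝ≥0), p ∈ e.source ∧
    ∀ q ∈ e.source, q ∈ B ↔ (e q).2 = 0

/-- An unoriented one-dimensional `X`-manifold: a closed one-manifold with exactly one base point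
on each component and a map to `X` sending the base points to `x₀`. -/
structure XMfd (X : Type*) [TopologicalSpace X] (x₀ : X) where
  carrier : Type
  [top : TopologicalSpace carrier]
  [t2 : T2Space carrier]
  [compact : CompactSpace carrier]
  charts : ∀ p : carrier, ∃ e : OpenPartialHomeomorph carrier ℝ, p ∈ e.source
  base : Set carrier
  base_unique : ∀ p : carrier, ∃! b, b ∈ base ∧ b ∈ connectedComponent p
  map : C(carrier, X)
  map_base : ∀ b ∈ base, map b = x₀

attribute [instance] XMfd.top XMfd.t2 XMfd.compact

section

variable {X : Type*} [TopologicalSpace X] {x₀ : X}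

/-- An `X`-homeomorphism of `X`-manifolds. -/
structure XHomeo (M N : XMfd X x₀) where
  homeo : M.carrier ≃ₜ N.carrier
  base_iff : ∀ p, homeo p ∈ N.base ↔ p ∈ M.base
  map_eq : ∀ p, N.map (homeo p) = M.map p

/-- Composition of `X`-homeomorphisms. -/
def XHomeo.trans {M N P : XMfd X x₀} (f : XHomeo M N) (g : XHomeo N P) : XHomeo M P where
  homeo := f.homeo.trans g.homeo
  base_iff p := (g.base_iff _).trans (f.base_iff p)
  map_eq p := (g.map_eq _).trans (f.map_eq p)

theorem mem_cc_inl {A B : Type*} [TopologicalSpace A] [TopologicalSpace B] (a : A) (z : A ⊕ B) :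
    z ∈ connectedComponent (Sum.inl a : A ⊕ B) ↔ ∃ b ∈ connectedComponent a, z = Sum.inl b := by
  constructor
  · intro hz
    have hcl : IsClopen (Set.range (Sum.inl : A → A ⊕ B)) :=
      ⟨isClosed_range_inl, isOpen_range_inl⟩
    have hsub := hcl.connectedComponent_subset (Set.mem_range_self a)
    obtain ⟨b, rfl⟩ := hsub hz
    refine ⟨b, ?_, rfl⟩
    have hpre : IsPreconnected (Sum.inl ⁻¹' (connectedComponent (Sum.inl a : A ⊕ B))) :=
      isPreconnected_connectedComponent.preimage_of_isOpenMap Sum.inl_injective isOpenMap_inl hsub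
    exact hpre.subset_connectedComponent mem_connectedComponent hz
  · rintro ⟨b, hb, rfl⟩
    exact continuous_inl.image_connectedComponent_subset a ⟨b, hb, rfl⟩

theorem mem_cc_inr {A B : Type*} [TopologicalSpace A] [TopologicalSpace B] (a : B) (z : A ⊕ B) :
    z ∈ connectedComponent (Sum.inr a : A ⊕ B) ↔ ∃ b ∈ connectedComponent a, z = Sum.inr b := by
  constructor
  · intro hz
    have hcl : IsClopen (Set.range (Sum.inr : B → A ⊕ B)) :=
      ⟨isClosed_range_inr, isOpen_range_inr⟩
    have hsub := hcl.connectedComponent_subset (Set.mem_range_self a)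
    obtain ⟨b, rfl⟩ := hsub hz
    refine ⟨b, ?_, rfl⟩
    have hpre : IsPreconnected (Sum.inr ⁻¹' (connectedComponent (Sum.inr a : A ⊕ B))) :=
      isPreconnected_connectedComponent.preimage_of_isOpenMap Sum.inr_injective isOpenMap_inr hsub
    exact hpre.subset_connectedComponent mem_connectedComponent hz
  · rintro ⟨b, hb, rfl⟩
    exact continuous_inr.image_connectedComponent_subset a ⟨b, hb, rfl⟩

/-- Disjoint union of `X`-manifolds. -/
def XMfd.sum (M N : XMfd X x₀) : XMfd X x₀ where
  carrier := M.carrier ⊕ N.carrier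
  charts := by
    rintro (p | p)
    · obtain ⟨e, he⟩ := M.charts p
      exact ⟨e.lift_openEmbedding Topology.IsOpenEmbedding.inl, by
        rw [OpenPartialHomeomorph.lift_openEmbedding_source]; exact ⟨p, he, rfl⟩⟩
    · obtain ⟨e, he⟩ := N.charts p
      exact ⟨e.lift_openEmbedding Topology.IsOpenEmbedding.inr, by
        rw [OpenPartialHomeomorph.lift_openEmbedding_source]; exact ⟨p, he, rfl⟩⟩
  base := {p | Sum.elim (· ∈ M.base) (· ∈ N.base) p}
  base_unique := by
    rintro (p | p)
    · obtain ⟨b, ⟨hb, hc⟩, hu⟩ := M.base_unique p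
      refine ⟨Sum.inl b, ⟨hb, (mem_cc_inl _ _).2 ⟨b, hc, rfl⟩⟩, ?_⟩
      rintro z ⟨hz, hz'⟩
      obtain ⟨y, hy, rfl⟩ := (mem_cc_inl _ _).1 hz'
      rw [hu y ⟨hz, hy⟩]
    · obtain ⟨b, ⟨hb, hc⟩, hu⟩ := N.base_unique p
      refine ⟨Sum.inr b, ⟨hb, (mem_cc_inr _ _).2 ⟨b, hc, rfl⟩⟩, ?_⟩
      rintro z ⟨hz, hz'⟩
      obtain ⟨y, hy, rfl⟩ := (mem_cc_inr _ _).1 hz'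
      rw [hu y ⟨hz, hy⟩]
  map := ⟨Sum.elim M.map N.map, M.map.continuous.sumElim N.map.continuous⟩
  map_base := by
    rintro (b | b) hb
    · exact M.map_base b hb
    · exact N.map_base b hb

/-- The empty `X`-manifold. -/
def XMfd.empty : XMfd X x₀ where
  carrier := Empty
  charts p := p.elim
  base := ∅
  base_unique p := p.elim
  map := ⟨Empty.elim, continuous_of_discreteTopology⟩
  map_base b := b.elim

/-- Disjoint union of `X`-homeomorphisms. -/
def XHomeo.sum {M N M' N' : XMfd X x₀} (f : XHomeo M M') (g : XHomeo N N') :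
    XHomeo (M.sum N) (M'.sum N') where
  homeo := f.homeo.sumCongr g.homeo
  base_iff := by
    rintro (p | p)
    · exact f.base_iff p
    · exact g.base_iff p
  map_eq := by
    rintro (p | p)
    · exact f.map_eq p
    · exact g.map_eq p

/-- `(M ⊔ N) ⊔ P ≅ M ⊔ (N ⊔ P)`. -/
def XHomeo.assoc (M N P : XMfd X x₀) : XHomeo ((M.sum N).sum P) (M.sum (N.sum P)) where
  homeo := Homeomorph.sumAssoc M.carrier N.carrier P.carrier
  base_iff := by rintro ((p | p) | p) <;> exact Iff.rfl
  map_eq := by rintro ((p | p) | p) <;> rfl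

/-- `M ⊔ N ≅ N ⊔ M`. -/
def XHomeo.comm (M N : XMfd X x₀) : XHomeo (M.sum N) (N.sum M) where
  homeo := Homeomorph.sumComm M.carrier N.carrier
  base_iff := by rintro (p | p) <;> exact Iff.rfl
  map_eq := by rintro (p | p) <;> rfl

/-- `M ⊔ ∅ ≅ M`. -/
def XHomeo.sumEmpty (M : XMfd X x₀) : XHomeo (M.sum XMfd.empty) M where
  homeo := haveI : IsEmpty (XMfd.empty : XMfd X x₀).carrier := inferInstanceAs (IsEmpty Empty)
    Homeomorph.sumEmpty M.carrier (XMfd.empty : XMfd X x₀).carrier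
  base_iff := by
    rintro (p | p)
    · exact Iff.rfl
    · exact Empty.elim p
  map_eq := by
    rintro (p | p)
    · rfl
    · exact Empty.elim p

/-- An unoriented `X`-cobordism from `M` (bottom) to `N` (top): a compact surface whose boundary is
the disjoint union of the images of `M` and `N`, with a characteristic map to `X`. -/
structure XCob (M N : XMfd X x₀) where
  carrier : Type
  [top : TopologicalSpace carrier]
  [t2 : T2Space carrier]
  [compact : CompactSpace carrier]
  bot : C(M.carrier, carrier)
  topm : C(N.carrier, carrier)
  bot_injective : Function.Injective bot
  topm_injective : Function.Injective topm
  disjoint : Disjoint (Set.range bot) (Set.range topm)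
  surface : IsSurfaceWithBoundary carrier (Set.range bot ∪ Set.range topm)
  map : C(carrier, X)
  map_bot : ∀ p, map (bot p) = M.map p
  map_topm : ∀ p, map (topm p) = N.map p

attribute [instance] XCob.top XCob.t2 XCob.compact

/-- `F` is an `X`-homeomorphism of cobordisms inducing `f` on the bottom and `f'` on the top. -/
def IsXHomeoOver {M N M' N' : XMfd X x₀} (W : XCob M N) (W' : XCob M' N')
    (f : XHomeo M M') (f' : XHomeo N N') (F : W.carrier ≃ₜ W'.carrier) : Prop :=
  (∀ p, F (W.bot p) = W'.bot (f.homeo p)) ∧ (∀ p, F (W.topm p) = W'.topm (f'.homeo p)) ∧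
    ∀ w, W'.map (F w) = W.map w

/-- `W` is the disjoint union of `W₀` and `W₁`. -/
def IsDisjointUnion {M N M' N' : XMfd X x₀} (W : XCob (M.sum M') (N.sum N'))
    (W₀ : XCob M N) (W₁ : XCob M' N') : Prop :=
  ∃ e : W₀.carrier ⊕ W₁.carrier ≃ₜ W.carrier,
    (∀ p, W.bot (Sum.inl p) = e (Sum.inl (W₀.bot p))) ∧
    (∀ p, W.bot (Sum.inr p) = e (Sum.inr (W₁.bot p))) ∧
    (∀ p, W.topm (Sum.inl p) = e (Sum.inl (W₀.topm p))) ∧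
    (∀ p, W.topm (Sum.inr p) = e (Sum.inr (W₁.topm p))) ∧
    (∀ w, W.map (e (Sum.inl w)) = W₀.map w) ∧ (∀ w, W.map (e (Sum.inr w)) = W₁.map w)

/-- `W` is obtained from `W₀` and `W₁` by gluing the top of `W₀` to the bottom of `W₁` along `f`
(all spaces being compact Hausdorff, this says that `W` is the pushout). -/
def IsGluing {M N N' P : XMfd X x₀} (W : XCob M P) (W₀ : XCob M N) (f : XHomeo N N')
    (W₁ : XCob N' P) : Prop :=
  ∃ (j₀ : C(W₀.carrier, W.carrier)) (j₁ : C(W₁.carrier, W.carrier)),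
    Function.Injective j₀ ∧ Function.Injective j₁ ∧ Set.range j₀ ∪ Set.range j₁ = Set.univ ∧
    (∀ x y, j₀ x = j₁ y ↔ ∃ n, x = W₀.topm n ∧ y = W₁.bot (f.homeo n)) ∧
    (∀ p, W.bot p = j₀ (W₀.bot p)) ∧ (∀ p, W.topm p = j₁ (W₁.topm p)) ∧
    (∀ w, W.map (j₀ w) = W₀.map w) ∧ (∀ w, W.map (j₁ w) = W₁.map w)

/-- `W` is a cylinder `M × [0,1]` whose characteristic map is constant on `{m} × [0,1]` for every
base point `m`. -/
def IsCylinder {M : XMfd X x₀} (W : XCob M M) : Prop :=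
  ∃ e : M.carrier × I ≃ₜ W.carrier, (∀ p, e (p, 0) = W.bot p) ∧ (∀ p, e (p, 1) = W.topm p) ∧
    ∀ m ∈ M.base, ∀ t, W.map (e (m, t)) = x₀

/-- `W` and `W'` differ by a homotopy of the characteristic map relative to the boundary. -/
def IsHomotopicRel {M N : XMfd X x₀} (W W' : XCob M N) : Prop :=
  ∃ e : W.carrier ≃ₜ W'.carrier, (∀ p, e (W.bot p) = W'.bot p) ∧
    (∀ p, e (W.topm p) = W'.topm p) ∧
    ContinuousMap.HomotopicRel W.map (W'.map.comp (e : C(W.carrier, W'.carrier)))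
      (Set.range W.bot ∪ Set.range W.topm)

end

/-! ### Homotopy quantum field theories -/

/-- An unoriented `(1+1)`-dimensional homotopy quantum field theory over `R` with target
`(X, x₀)`. The natural identifications `A(M ⊔ N) = A(M) ⊗ A(N)` and `A(∅) = R` are coherent with
associativity, commutativity and unit of disjoint unions. -/
structure HQFT.{v, w, u} (R : Type w) [CommRing R] (X : Type u) [TopologicalSpace X] (x₀ : X) where
  obj : XMfd X x₀ → ModuleCat.{v} R
  finite : ∀ M, Module.Finite R (obj M)
  projective : ∀ M, Module.Projective R (obj M)
  push : ∀ {M N : XMfd X x₀}, XHomeo M N → (obj M ≃ₗ[R] obj N)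
  τ : ∀ {M N : XMfd X x₀}, XCob M N → (obj M →ₗ[R] obj N)
  push_trans : ∀ {M N P : XMfd X x₀} (f : XHomeo M N) (g : XHomeo N P) (a : obj M),
    push (f.trans g) a = push g (push f a)
  tensor : ∀ M N : XMfd X x₀, obj (M.sum N) ≃ₗ[R] obj M ⊗[R] obj N
  unit : obj XMfd.empty ≃ₗ[R] R
  tensor_natural : ∀ {M N M' N' : XMfd X x₀} (f : XHomeo M M') (g : XHomeo N N')
    (a : obj (M.sum N)),
    tensor M' N' (push (f.sum g) a) = TensorProduct.congr (push f) (push g) (tensor M N a)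
  tensor_assoc : ∀ (M N P : XMfd X x₀) (a : obj ((M.sum N).sum P)),
    TensorProduct.assoc R (obj M) (obj N) (obj P)
        (TensorProduct.congr (tensor M N) (LinearEquiv.refl R (obj P)) (tensor (M.sum N) P a)) =
      TensorProduct.congr (LinearEquiv.refl R (obj M)) (tensor N P)
        (tensor M (N.sum P) (push (XHomeo.assoc M N P) a))
  tensor_comm : ∀ (M N : XMfd X x₀) (a : obj (M.sum N)),
    tensor N M (push (XHomeo.comm M N) a) = TensorProduct.comm R (obj M) (obj N) (tensor M N a)
  tensor_unit : ∀ (M : XMfd X x₀) (a : obj (M.sum XMfd.empty)),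
    TensorProduct.rid R (obj M)
        (TensorProduct.congr (LinearEquiv.refl R (obj M)) unit (tensor M XMfd.empty a)) =
      push (XHomeo.sumEmpty M) a
  τ_natural : ∀ {M N M' N' : XMfd X x₀} (W : XCob M N) (W' : XCob M' N')
    (f : XHomeo M M') (f' : XHomeo N N') (F : W.carrier ≃ₜ W'.carrier),
    IsXHomeoOver W W' f f' F → ∀ a, τ W' (push f a) = push f' (τ W a)
  τ_sum : ∀ {M N M' N' : XMfd X x₀} (W : XCob (M.sum M') (N.sum N')) (W₀ : XCob M N)
    (W₁ : XCob M' N'), IsDisjointUnion W W₀ W₁ →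
    ∀ a, tensor N N' (τ W a) = TensorProduct.map (τ W₀) (τ W₁) (tensor M M' a)
  τ_gluing : ∀ {M N N' P : XMfd X x₀} (W : XCob M P) (W₀ : XCob M N) (f : XHomeo N N')
    (W₁ : XCob N' P), IsGluing W W₀ f W₁ → ∀ a, τ W a = τ W₁ (push f (τ W₀ a))
  τ_cylinder : ∀ {M : XMfd X x₀} (W : XCob M M), IsCylinder W → τ W = LinearMap.id
  τ_homotopy : ∀ {M N : XMfd X x₀} (W W' : XCob M N), IsHomotopicRel W W' → τ W = τ W'

section

variable {X : Type*} [TopologicalSpace X] {x₀ : X}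

/-- The cobordism `W` from `∅` to four circles, parametrized by `c`, consists of a tube joining the
circles `i` and `j` and of two discs bounded by the other two circles, and its characteristic map
is constant. -/
def IsTubeAndDiscs {M : XMfd X x₀} (c : Fin 4 × Circle ≃ₜ M.carrier) (i j : Fin 4)
    (W : XCob XMfd.empty M) : Prop :=
  (∀ w, W.map w = x₀) ∧
  ∃ e : (Circle × I) ⊕ ({k : Fin 4 // k ≠ i ∧ k ≠ j} × Metric.closedBall (0 : ℂ) 1) ≃ₜ W.carrier,
    (∀ z, e (Sum.inl (z, 0)) = W.topm (c (i, z))) ∧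
    (∀ z, e (Sum.inl (z, 1)) = W.topm (c (j, z))) ∧
    ∀ k (z : Circle), e (Sum.inr (k, ⟨z, by simp [Circle.norm_coe]⟩)) = W.topm (c (k.1, z))

/-- The theory respects the S relation (a sphere is `0`), the T relation (a torus is `2`) and the
4-Tu relation. -/
structure HQFT.RespectsSTTu {R : Type*} [CommRing R] (A : HQFT R X x₀) : Prop where
  sphere : ∀ W : XCob (XMfd.empty : XMfd X x₀) XMfd.empty,
    Nonempty (W.carrier ≃ₜ Metric.sphere (0 : EuclideanSpace ℝ (Fin 3)) 1) →
    (∀ w, W.map w = x₀) → A.τ W = 0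
  torus : ∀ W : XCob (XMfd.empty : XMfd X x₀) XMfd.empty,
    Nonempty (W.carrier ≃ₜ Circle × Circle) →
    (∀ w, W.map w = x₀) → A.τ W = (2 : R) • LinearMap.id
  fourTube : ∀ (M : XMfd X x₀) (c : Fin 4 × Circle ≃ₜ M.carrier)
    (W₁ W₂ W₃ W₄ : XCob XMfd.empty M),
    IsTubeAndDiscs c 0 1 W₁ → IsTubeAndDiscs c 2 3 W₂ →
    IsTubeAndDiscs c 0 2 W₃ → IsTubeAndDiscs c 1 3 W₄ →
    A.τ W₁ + A.τ W₂ = A.τ W₃ + A.τ W₄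

end

/-! ### Target spaces -/

/-- First singular homology with coefficients in the field with two elements. -/
abbrev H1 (Y : Type) [TopologicalSpace Y] : ModuleCat.{0} (ZMod 2) :=
  ((AlgebraicTopology.singularHomologyFunctor (ModuleCat.{0} (ZMod 2)) 1).obj
    (ModuleCat.of (ZMod 2) (ZMod 2))).obj (TopCat.of Y)

/-- The map induced on first homology by a continuous map. -/
def H1map {Y Z : Type} [TopologicalSpace Y] [TopologicalSpace Z] (f : C(Y, Z)) :
    H1 Y →ₗ[ZMod 2] H1 Z :=
  (((AlgebraicTopology.singularHomologyFunctor (ModuleCat.{0} (ZMod 2)) 1).obj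
    (ModuleCat.of (ZMod 2) (ZMod 2))).map (TopCat.ofHom f)).hom

/-- `X` is a CW complex of type `K(G, 1)`, with the identification of `π₁(X, x₀)` with `G`. -/
structure EilenbergMacLaneOne (X : Type*) [TopologicalSpace X] (x₀ : X) (G : Type*) [Group G] where
  t2 : T2Space X
  cw : Nonempty (Topology.CWComplex (Set.univ : Set X))
  pathConnected : PathConnectedSpace X
  higher : ∀ n : ℕ, 2 ≤ n → Subsingleton (HomotopyGroup.Pi n X x₀)
  equiv : FundamentalGroup X x₀ ≃* G

/-- The closed path `t ↦ g (exp (2πit))`. -/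
def circlePath {X : Type*} [TopologicalSpace X] (g : C(Circle, X)) : Path (g 1) (g 1) where
  toFun t := g (Circle.exp (2 * Real.pi * t))
  continuous_toFun := by fun_prop
  source' := by simp
  target' := by simp

/-- A map `h : F → X = K(H₁(F; 𝔽₂), 1)` realizing the labels: it sends every loop of `F`, joined to
the base point along any path `q`, to its homology class in `H₁(F; 𝔽₂) = π₁(X, x₀)`. The class of a
loop is the image of the fundamental class of the circle, i.e. of the nonzero element of
`H₁(S¹; 𝔽₂)`. -/
def RealizesLabels {F : Type} [TopologicalSpace F] {X : Type*} [TopologicalSpace X] {x₀ : X}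
    (K : EilenbergMacLaneOne X x₀ (Multiplicative (H1 F))) (h : C(F, X)) : Prop :=
  ∀ (γ : C(Circle, F)) (q : Path x₀ (h (γ 1))) (c : H1 Circle), c ≠ 0 →
    K.equiv (FundamentalGroup.fromPath
        (Path.Homotopic.Quotient.mk ((q.trans (circlePath (h.comp γ))).trans q.symm))) =
      Multiplicative.ofAdd (H1map γ c)

/-! ### Oriented surfaces and link diagrams -/

/-- `f` preserves the orientation of the plane at `p`: it winds small positive circles around `p`
once positively around `f p`. -/
def PreservesOrientationAt (f : ℂ → ℂ) (p : ℂ) : Prop :=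
  ∀ᶠ r : ℝ in 𝓝[>] (0 : ℝ), ∃ θ : ℝ → ℝ, Continuous θ ∧
    (∀ t, θ (t + 2 * Real.pi) = θ t + 2 * Real.pi) ∧
    ∀ t : ℝ, f (p + r * Complex.exp (t * Complex.I)) - f p =
      ‖f (p + r * Complex.exp (t * Complex.I)) - f p‖ * Complex.exp (θ t * Complex.I)

theorem PreservesOrientationAt.comp_rot {f : ℂ → ℂ} {p w : ℂ} (φ : ℝ)
    (hw : w = Complex.exp (φ * Complex.I)) (h : PreservesOrientationAt f (w * p)) :
    PreservesOrientationAt (fun z => f (w * z)) p := by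
  filter_upwards [h] with r hr
  obtain ⟨θ, hc, hp, he⟩ := hr
  refine ⟨fun t => θ (t + φ), by fun_prop, fun t => ?_, fun t => ?_⟩
  · have := hp (t + φ)
    rw [← this]; ring_nf
  · have key : w * (p + r * Complex.exp (t * Complex.I)) =
        w * p + r * Complex.exp (((t + φ : ℝ) : ℂ) * Complex.I) := by
      rw [hw]; push_cast; rw [add_mul (t : ℂ), Complex.exp_add]; ring
    simp only [key]
    exact he (t + φ)

/-- An oriented surface, possibly with boundary: the orientation is given by an atlas of the
interior whose changes of charts preserve the orientation of the plane. -/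
structure OrientedSurface (F : Type) [TopologicalSpace F] where
  boundary : Set F
  surface : IsSurfaceWithBoundary F boundary
  atlas : Set (OpenPartialHomeomorph F ℂ)
  covers : ∀ p ∉ boundary, ∃ e ∈ atlas, p ∈ e.source
  compatible : ∀ e ∈ atlas, ∀ e' ∈ atlas, ∀ p ∈ e.source ∩ e'.source,
    PreservesOrientationAt (fun z => e' (e.symm z)) (e p)

/-- An orientation preserving embedding of the line into a disjoint union of circles. -/
def IsPositiveArc {m : ℕ} (a : ℝ → Fin m × Circle) : Prop :=
  Function.Injective a ∧ ∃ (k : Fin m) (θ : ℝ → ℝ), Continuous θ ∧ StrictMono θ ∧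
    ∀ t, a t = (k, Circle.exp (θ t))

/-- The curve `u² - v² = s max(0, 1 - u² - v²)` in the plane. For every `s` it agrees with the two
diagonals outside the unit disc. It is the crossing `⨯` for `s = 0`, the smoothing `)(` for `s = 1`
and the smoothing `≍` for `s = -1`. -/
def curve (s : ℝ) : Set ℂ :=
  {z | z.re ^ 2 - z.im ^ 2 = s * max 0 (1 - z.re ^ 2 - z.im ^ 2)}

variable {F : Type} [TopologicalSpace F]

/-- An oriented link diagram with `n` ordered crossings on an oriented surface `F`: an immersion `γ`
of finitely many oriented circles whose only multiple points are `n` double points. Around the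
`i`-th one there is a positively oriented planar chart `chart i`, in which the diagram is the union
of the diagonals, the over strand being `/`, directed upwards. The under strand `\` is directed
upwards if the crossing is positive, downwards if it is negative. -/
structure Diagram (S : OrientedSurface F) (n : ℕ) where
  components : ℕ
  γ : C(Fin components × Circle, F)
  chart : Fin n → ℂ → F
  chart_open : ∀ i, Topology.IsOpenEmbedding (chart i)
  chart_oriented : ∀ i, ∀ e ∈ S.atlas, ∀ z, chart i z ∈ e.source →
    PreservesOrientationAt (fun w => e (chart i w)) z
  chart_disjoint : ∀ i j, i ≠ j → Disjoint (Set.range (chart i)) (Set.range (chart j))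
  chart_mem : ∀ i z, chart i z ∈ Set.range γ ↔ z.re ^ 2 = z.im ^ 2
  positive : Fin n → Bool
  overArc : Fin n → ℝ → Fin components × Circle
  underArc : Fin n → ℝ → Fin components × Circle
  overArc_pos : ∀ i, IsPositiveArc (overArc i)
  underArc_pos : ∀ i, IsPositiveArc (underArc i)
  γ_over : ∀ i t, γ (overArc i t) = chart i (t * (1 + Complex.I))
  γ_under : ∀ i t, γ (underArc i t) =
    chart i (if positive i then t * (-1 + Complex.I) else t * (1 - Complex.I))
  γ_double : ∀ s t, γ s = γ t → s = t ∨ ∃ i, (s = overArc i 0 ∧ t = underArc i 0) ∨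
    (s = underArc i 0 ∧ t = overArc i 0)
  flat : ∀ p ∈ Set.range γ, (∀ i, p ∉ Set.range (chart i)) →
    ∃ φ : ℂ → F, Topology.IsOpenEmbedding φ ∧ p ∈ Set.range φ ∧
      ∀ z, φ z ∈ Set.range γ ↔ z.im = 0

namespace Diagram

variable {S : OrientedSurface F} {n : ℕ}

/-- The number of negative crossings. -/
def negCrossings (D : Diagram S n) : ℕ :=
  (Finset.univ.filter fun i => D.positive i = false).card

/-- The quarter turn, positive or negative, which moves the under strand of a crossing with the
given sign to the standard over strand. -/
def quarterTurn (b : Bool) : ℂ := if b then Complex.I else -Complex.I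

theorem quarterTurn_ne_zero (b : Bool) : quarterTurn b ≠ 0 := by
  cases b <;> simp [quarterTurn]

/-- Multiplication by a quarter turn as a homeomorphism. -/
def quarterTurnHomeo (b : Bool) : ℂ ≃ₜ ℂ := Homeomorph.mulLeft₀ _ (quarterTurn_ne_zero b)

theorem quarterTurn_sq (b : Bool) (z : ℂ) :
    ((quarterTurn b * z).re ^ 2 = z.im ^ 2) ∧ ((quarterTurn b * z).im ^ 2 = z.re ^ 2) := by
  cases b <;> simp [quarterTurn]

theorem range_quarterTurn {Y : Type*} (f : ℂ → Y) (b : Bool) :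
    Set.range (fun z => f (quarterTurn b * z)) = Set.range f :=
  (quarterTurnHomeo b).surjective.range_comp f

/-- The mirror diagram `D^!`: all crossings are changed. The over strand becomes the under strand
and every sign is reversed; the charts are rotated by a quarter turn to put the new over strand in
standard position. -/
def mirror (D : Diagram S n) : Diagram S n where
  components := D.components
  γ := D.γ
  chart i z := D.chart i (quarterTurn (D.positive i) * z)
  chart_open i := (D.chart_open i).comp (quarterTurnHomeo (D.positive i)).isOpenEmbedding
  chart_oriented i e he z hz := by
    have h := D.chart_oriented i e he _ hz
    cases hb : D.positive i
    · rw [hb] at h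
      refine PreservesOrientationAt.comp_rot (f := fun w => e (D.chart i w)) (-(Real.pi / 2)) ?_ h
      rw [show ((-(Real.pi / 2) : ℝ) : ℂ) * Complex.I = -(Real.pi : ℂ) / 2 * Complex.I by
        push_cast; ring, Complex.exp_neg_pi_div_two_mul_I]
      rfl
    · rw [hb] at h
      refine PreservesOrientationAt.comp_rot (f := fun w => e (D.chart i w)) (Real.pi / 2) ?_ h
      rw [show ((Real.pi / 2 : ℝ) : ℂ) * Complex.I = (Real.pi / 2 : ℂ) * Complex.I by
        push_cast; ring, Complex.exp_pi_div_two_mul_I]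
      rfl
  chart_disjoint i j hij := by
    rw [range_quarterTurn, range_quarterTurn]; exact D.chart_disjoint i j hij
  chart_mem i z := by
    rw [D.chart_mem, (quarterTurn_sq _ z).1, (quarterTurn_sq _ z).2, eq_comm]
  positive i := !D.positive i
  overArc := D.underArc
  underArc := D.overArc
  overArc_pos := D.underArc_pos
  underArc_pos := D.overArc_pos
  γ_over i t := by
    rw [D.γ_under]
    cases D.positive i
    · simp only [quarterTurn]; congr 1; simp; linear_combination (t : ℂ) * Complex.I_sq
    · simp only [quarterTurn]; congr 1; simp; linear_combination (-(t : ℂ)) * Complex.I_sq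
  γ_under i t := by
    rw [D.γ_over]
    cases D.positive i
    · simp only [quarterTurn]; congr 1; simp; linear_combination (t : ℂ) * Complex.I_sq
    · simp only [quarterTurn]; congr 1; simp; linear_combination (t : ℂ) * Complex.I_sq
  γ_double s t h := by
    rcases D.γ_double s t h with h | ⟨i, h | h⟩
    · exact Or.inl h
    · exact Or.inr ⟨i, Or.inr h⟩
    · exact Or.inr ⟨i, Or.inl h⟩
  flat p hp hpi := D.flat p hp fun i => by
    have := hpi i
    rwa [range_quarterTurn] at this

/-- The parameter of the curve used for a smoothing: `)(` for `0`, `≍` for `1`. -/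
def level (b : Bool) : ℝ := if b then -1 else 1

/-- The smoothing `D_ε`: inside the chart around the `i`-th crossing the diagram is replaced by the
`0`-smoothing or the `1`-smoothing according to `ε i`. -/
def smoothing (D : Diagram S n) (ε : Fin n → Bool) : Set F :=
  {p | (p ∈ Set.range D.γ ∧ ∀ i, p ∉ Set.range (D.chart i)) ∨
    ∃ i z, p = D.chart i z ∧ z ∈ curve (level (ε i))}

/-- The surface in `F × [0,1]` which is `D_ε × [0,1]` away from the `j`-th crossing and a saddle
inside the chart around it. -/
def saddleSet (D : Diagram S n) (ε : Fin n → Bool) (j : Fin n) : Set (F × I) :=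
  {x | (x.1 ∈ D.smoothing ε ∧ x.1 ∉ Set.range (D.chart j)) ∨
    ∃ z, x.1 = D.chart j z ∧ z ∈ curve (1 - 2 * (x.2 : ℝ))}

theorem curve_rot (s : ℝ) (z : ℂ) : quarterTurn true * z ∈ curve s ↔ z ∈ curve (-s) := by
  simp only [curve, Set.mem_ofPred_eq, (quarterTurn_sq true z).1, (quarterTurn_sq true z).2]
  rw [show 1 - z.im ^ 2 - z.re ^ 2 = 1 - z.re ^ 2 - z.im ^ 2 by ring]
  constructor <;> intro h <;> linarith

theorem curve_neg (s : ℝ) (z : ℂ) : -z ∈ curve s ↔ z ∈ curve s := by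
  simp [curve]

theorem curve_outside {s : ℝ} {z : ℂ} (h : 1 < z.re ^ 2 + z.im ^ 2) :
    z ∈ curve s ↔ z.re ^ 2 = z.im ^ 2 := by
  simp only [curve, Set.mem_ofPred_eq]
  rw [max_eq_left (by linarith), mul_zero, sub_eq_zero]

theorem isClosed_curve (s : ℝ) : IsClosed (curve s) :=
  isClosed_eq (by fun_prop) (by fun_prop)

theorem chart_inj (D : Diagram S n) {i j : Fin n} {z w : ℂ} (h : D.chart i z = D.chart j w) :
    i = j ∧ z = w := by
  have hij : i = j := by
    by_contra hne
    exact Set.disjoint_left.1 (D.chart_disjoint i j hne) ⟨z, rfl⟩ ⟨w, h.symm⟩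
  subst hij
  exact ⟨rfl, (D.chart_open i).injective h⟩

theorem chart_mem_smoothing (D : Diagram S n) (ε : Fin n → Bool) (i : Fin n) (z : ℂ) :
    D.chart i z ∈ D.smoothing ε ↔ z ∈ curve (level (ε i)) := by
  constructor
  · rintro (⟨-, h⟩ | ⟨j, w, h, hw⟩)
    · exact absurd ⟨z, rfl⟩ (h i)
    · obtain ⟨rfl, rfl⟩ := D.chart_inj h
      exact hw
  · exact fun h => Or.inr ⟨i, z, rfl, h⟩

theorem chart_mem_saddleSet (D : Diagram S n) (ε : Fin n → Bool) (j : Fin n) (z : ℂ) (t : I) :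
    (D.chart j z, t) ∈ D.saddleSet ε j ↔ z ∈ curve (1 - 2 * (t : ℝ)) := by
  constructor
  · rintro (⟨-, h⟩ | ⟨w, h, hw⟩)
    · exact absurd ⟨z, rfl⟩ h
    · obtain ⟨-, rfl⟩ := D.chart_inj h
      exact hw
  · exact fun h => Or.inr ⟨z, rfl, h⟩

/-- The union of the closed unit discs in the crossing charts. -/
def core (D : Diagram S n) : Set F :=
  ⋃ i, D.chart i '' Metric.closedBall 0 1

theorem mem_closedBall_iff (z : ℂ) :
    z ∈ Metric.closedBall (0 : ℂ) 1 ↔ z.re ^ 2 + z.im ^ 2 ≤ 1 := by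
  rw [mem_closedBall_zero_iff, ← sq_le_one_iff₀ (norm_nonneg z), Complex.sq_norm,
    Complex.normSq_apply]
  constructor <;> intro h <;> nlinarith

theorem isClosed_core [T2Space F] (D : Diagram S n) : IsClosed D.core :=
  isClosed_iUnion_of_finite fun i =>
    ((isCompact_closedBall (0 : ℂ) 1).image (D.chart_open i).continuous).isClosed

theorem mem_smoothing_of_notMem_core (D : Diagram S n) (ε : Fin n → Bool) {p : F}
    (hp : p ∉ D.core) : p ∈ D.smoothing ε ↔ p ∈ Set.range D.γ := by
  by_cases hc : ∃ i, p ∈ Set.range (D.chart i)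
  · obtain ⟨i, z, rfl⟩ := hc
    have hz : 1 < z.re ^ 2 + z.im ^ 2 := by
      by_contra hz
      exact hp (Set.mem_iUnion.2 ⟨i, z, (mem_closedBall_iff z).2 (not_lt.1 hz), rfl⟩)
    rw [chart_mem_smoothing, curve_outside hz, D.chart_mem]
  · push Not at hc
    constructor
    · rintro (⟨h, -⟩ | ⟨i, z, h, -⟩)
      · exact h
      · exact absurd ⟨z, h.symm⟩ (hc i)
    · exact fun h => Or.inl ⟨h, hc⟩

theorem mem_saddleSet_of_notMem (D : Diagram S n) (ε : Fin n → Bool) (j : Fin n) {p : F} (t : I)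
    (hp : p ∉ D.chart j '' Metric.closedBall 0 1) :
    (p, t) ∈ D.saddleSet ε j ↔ p ∈ D.smoothing ε := by
  by_cases hc : p ∈ Set.range (D.chart j)
  · obtain ⟨z, rfl⟩ := hc
    have hz : 1 < z.re ^ 2 + z.im ^ 2 := by
      by_contra hz
      exact hp ⟨z, (mem_closedBall_iff z).2 (not_lt.1 hz), rfl⟩
    rw [chart_mem_smoothing, chart_mem_saddleSet, curve_outside hz, curve_outside hz]
  · constructor
    · rintro (⟨h, -⟩ | ⟨z, h, -⟩)
      · exact h
      · exact absurd ⟨z, h.symm⟩ hc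
    · exact fun h => Or.inl ⟨h, hc⟩

theorem isClosed_smoothing [T2Space F] (D : Diagram S n) (ε : Fin n → Bool) :
    IsClosed (D.smoothing ε) := by
  rw [← closure_subset_iff_isClosed]
  intro p hp
  by_cases hc : p ∈ D.core
  · obtain ⟨i, z, -, rfl⟩ := Set.mem_iUnion.1 hc
    rw [chart_mem_smoothing]
    have h1 : z ∈ D.chart i ⁻¹' closure (D.smoothing ε) := hp
    rw [(D.chart_open i).isOpenMap.preimage_closure_eq_closure_preimage
      (D.chart_open i).continuous] at h1
    have h2 : D.chart i ⁻¹' D.smoothing ε = curve (level (ε i)) := by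
      ext w; exact D.chart_mem_smoothing ε i w
    rwa [h2, (isClosed_curve _).closure_eq] at h1
  · rw [mem_smoothing_of_notMem_core D ε hc]
    have h1 : p ∈ closure (D.coreᶜ ∩ D.smoothing ε) :=
      (D.isClosed_core.isOpen_compl).inter_closure ⟨hc, hp⟩
    have h2 : IsClosed (Set.range D.γ) := (isCompact_range D.γ.continuous).isClosed
    rw [← h2.closure_eq]
    exact closure_mono (fun q hq => (mem_smoothing_of_notMem_core D ε hq.1).1 hq.2) h1

theorem isClosed_saddleSet [T2Space F] (D : Diagram S n) (ε : Fin n → Bool) (j : Fin n) :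
    IsClosed (D.saddleSet ε j) := by
  rw [← closure_subset_iff_isClosed]
  rintro ⟨p, t⟩ hp
  have hK : IsClosed (D.chart j '' Metric.closedBall 0 1) :=
    ((isCompact_closedBall (0 : ℂ) 1).image (D.chart_open j).continuous).isClosed
  by_cases hc : p ∈ D.chart j '' Metric.closedBall 0 1
  · obtain ⟨z, -, rfl⟩ := hc
    rw [chart_mem_saddleSet]
    have ho : Topology.IsOpenEmbedding (Prod.map (D.chart j) (id : I → I)) :=
      (D.chart_open j).prodMap Topology.IsOpenEmbedding.id
    have h1 : (z, t) ∈ Prod.map (D.chart j) (id : I → I) ⁻¹' closure (D.saddleSet ε j) := hp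
    rw [ho.isOpenMap.preimage_closure_eq_closure_preimage ho.continuous] at h1
    have h2 : Prod.map (D.chart j) (id : I → I) ⁻¹' D.saddleSet ε j =
        {x : ℂ × I | x.1.re ^ 2 - x.1.im ^ 2 =
          (1 - 2 * (x.2 : ℝ)) * max 0 (1 - x.1.re ^ 2 - x.1.im ^ 2)} := by
      ext ⟨w, r⟩; exact D.chart_mem_saddleSet ε j w r
    have h3 : IsClosed {x : ℂ × I | x.1.re ^ 2 - x.1.im ^ 2 =
          (1 - 2 * (x.2 : ℝ)) * max 0 (1 - x.1.re ^ 2 - x.1.im ^ 2)} :=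
      isClosed_eq (by fun_prop) (by fun_prop)
    rw [h2, h3.closure_eq] at h1
    exact h1
  · rw [mem_saddleSet_of_notMem D ε j t hc]
    have hO : IsOpen {x : F × I | x.1 ∉ D.chart j '' Metric.closedBall 0 1} :=
      hK.isOpen_compl.preimage continuous_fst
    have h1 : (p, t) ∈ closure ({x : F × I | x.1 ∉ D.chart j '' Metric.closedBall 0 1} ∩
        D.saddleSet ε j) := hO.inter_closure ⟨hc, hp⟩
    have h2 : IsClosed {x : F × I | x.1 ∈ D.smoothing ε} :=
      (D.isClosed_smoothing ε).preimage continuous_fst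
    have h3 : (p, t) ∈ closure {x : F × I | x.1 ∈ D.smoothing ε} :=
      closure_mono (by
        rintro ⟨q, r⟩ ⟨hq, hq'⟩
        exact (mem_saddleSet_of_notMem D ε j r hq).1 hq') h1
    rw [h2.closure_eq] at h3
    exact h3

/-! #### Charts of smoothings and of saddles -/

theorem chart_of_flat {Y H : Type*} [TopologicalSpace Y] [TopologicalSpace H] (T : Set Y)
    (e : OpenPartialHomeomorph Y (H × ℝ)) (he : ∀ q ∈ e.source, q ∈ T ↔ (e q).2 = 0)
    (p : T) (hp : p.1 ∈ e.source) :
    ∃ e' : OpenPartialHomeomorph T H, p ∈ e'.source ∧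
      ∀ q ∈ e'.source, q.1 ∈ e.source ∧ e' q = (e q.1).1 := by
  classical
  have hmem : ∀ x : H, (x, (0 : ℝ)) ∈ e.target → e.symm (x, 0) ∈ T := fun x hx => by
    rw [he _ (e.map_target hx), e.right_inv hx]
  have hsrc : ∀ q : T, q.1 ∈ e.source → ((e q.1).1, (0 : ℝ)) = e q.1 := fun q hq =>
    Prod.ext rfl ((he _ hq).1 q.2).symm
  let g : H → T := fun x => if hx : (x, (0 : ℝ)) ∈ e.target then ⟨e.symm (x, 0), hmem x hx⟩ else p
  have hg : ∀ x, (x, (0 : ℝ)) ∈ e.target → (g x).1 = e.symm (x, 0) := fun x hx => by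
    simp only [g, dif_pos hx]
  refine ⟨{ toFun := fun q => (e q.1).1
            invFun := g
            source := Subtype.val ⁻¹' e.source
            target := {x | (x, (0 : ℝ)) ∈ e.target}
            map_source' := ?_
            map_target' := ?_
            left_inv' := ?_
            right_inv' := ?_
            open_source := e.open_source.preimage continuous_subtype_val
            open_target := e.open_target.preimage (by fun_prop)
            continuousOn_toFun := ?_
            continuousOn_invFun := ?_ }, hp, fun q hq => ⟨hq, rfl⟩⟩
  · intro q hq
    have h := hsrc q hq
    show ((e q.1).1, (0 : ℝ)) ∈ e.target
    rw [h]
    exact e.map_source hq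
  · intro x hx
    show (g x).1 ∈ e.source
    rw [hg x hx]
    exact e.map_target hx
  · intro q hq
    have h := hsrc q hq
    apply Subtype.ext
    show (g (e q.1).1).1 = q.1
    rw [hg _ (by rw [h]; exact e.map_source hq), h, e.left_inv hq]
  · intro x hx
    show (e (g x).1).1 = x
    rw [hg x hx, e.right_inv hx]
  · exact continuous_fst.comp_continuousOn
      (e.continuousOn.comp continuous_subtype_val.continuousOn fun q hq => hq)
  · rw [Topology.IsInducing.subtypeVal.continuousOn_iff]
    refine ContinuousOn.congr (f := fun x => e.symm (x, 0)) ?_ fun x hx => hg x hx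
    exact e.continuousOn_symm.comp (by fun_prop) fun x hx => hx

/-- Near `p` the subset `T` of `F` is a flat curve. -/
def FlatAt {F : Type} [TopologicalSpace F] (T : Set F) (p : F) : Prop :=
  ∃ e : OpenPartialHomeomorph F (ℝ × ℝ), p ∈ e.source ∧ ∀ q ∈ e.source, q ∈ T ↔ (e q).2 = 0

/-- Near `x` the subset `T` of `F × [0,1]` is a flat surface transverse to the slices `F × {t}`. -/
def TransverseAt {F : Type} [TopologicalSpace F] (T : Set (F × I)) (x : F × I) : Prop :=
  ∃ e : OpenPartialHomeomorph (F × I) ((ℝ × I) × ℝ), x ∈ e.source ∧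
    (∀ q ∈ e.source, q ∈ T ↔ (e q).2 = 0) ∧ ∀ q ∈ e.source, (e q).1.2 = q.2

/-- The branch `u = u(v)` of the curve with parameter `s`, as long as `d ≤ 1 + s`. -/
def branch (d s v : ℝ) : ℝ := Real.sqrt (v ^ 2 + s * (max 0 (1 - 2 * v ^ 2) / max d (1 + s)))

theorem mem_curve_iff_branch {d s : ℝ} (hd : 0 < d) (hs : d ≤ 1 + s) {z : ℂ} (hz : 0 < z.re) :
    z ∈ curve s ↔ z.re - branch d s z.im = 0 := by
  have h1 : 0 < 1 + s := hd.trans_le hs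
  rw [sub_eq_zero, branch, max_eq_right hs, curve, Set.mem_ofPred_eq]
  set u := z.re
  set v := z.im
  constructor
  · intro h
    rw [eq_comm, Real.sqrt_eq_iff_mul_self_eq_of_pos hz, ← pow_two]
    rcases le_total (1 - u ^ 2 - v ^ 2) 0 with h2 | h2
    · rw [max_eq_left h2] at h
      rw [max_eq_left (by linarith), zero_div]
      linarith
    · rw [max_eq_right h2] at h
      have h3 : 0 ≤ 1 - 2 * v ^ 2 := by
        have := mul_nonneg h1.le h2
        nlinarith
      rw [max_eq_right h3]
      field_simp
      linarith
  · intro h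
    have h0 : u ^ 2 = v ^ 2 + s * (max 0 (1 - 2 * v ^ 2) / (1 + s)) := by
      rw [eq_comm, Real.sqrt_eq_iff_mul_self_eq_of_pos hz, ← pow_two] at h
      exact h
    rcases le_total (1 - 2 * v ^ 2) 0 with h2 | h2
    · rw [max_eq_left h2, zero_div, mul_zero] at h0
      rw [max_eq_left (by linarith)]
      linarith
    · rw [max_eq_right h2] at h0
      have h3 : (1 + s) * (u ^ 2 - v ^ 2) = s * (1 - 2 * v ^ 2) := by
        rw [h0]; field_simp; ring
      have h4 : (1 + s) * (1 - u ^ 2 - v ^ 2) = 1 - 2 * v ^ 2 := by linarith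
      have h5 : 0 ≤ 1 - u ^ 2 - v ^ 2 := by
        by_contra h6
        push Not at h6
        have := mul_neg_of_pos_of_neg h1 h6
        linarith
      rw [max_eq_right h5]
      have h6 : (1 + s) * (u ^ 2 - v ^ 2 - s * (1 - u ^ 2 - v ^ 2)) = 0 := by
        rw [mul_sub, h3, mul_left_comm, h4]; ring
      rcases mul_eq_zero.1 h6 with h7 | h7 <;> linarith

theorem continuous_branch {d : ℝ} (hd : 0 < d) :
    Continuous fun x : ℝ × ℝ => branch d x.1 x.2 := by
  have h : ∀ x : ℝ × ℝ, max d (1 + x.1) ≠ 0 := fun x => (hd.trans_le (le_max_left _ _)).ne'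
  unfold branch
  fun_prop (disch := exact h _)

/-- The shear `(z, y) ↦ ((im z, y), re z - f (im z, y))`. -/
def shear {P : Type*} [TopologicalSpace P] (f : ℝ × P → ℝ) (hf : Continuous f) :
    ℂ × P ≃ₜ (ℝ × P) × ℝ where
  toFun x := ((x.1.im, x.2), x.1.re - f (x.1.im, x.2))
  invFun y := (⟨y.2 + f y.1, y.1.1⟩, y.1.2)
  left_inv x := by simp
  right_inv y := by simp
  continuous_toFun := by fun_prop
  continuous_invFun := by
    refine Continuous.prodMk ?_ (by fun_prop)
    exact Complex.equivRealProdCLM.symm.continuous.comp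
      (f := fun y : (ℝ × P) × ℝ => (y.2 + f y.1, y.1.1)) (by fun_prop)

theorem transverseAt_of_re_pos {T : Set (F × I)} {c : ℂ → F} (hc : Topology.IsOpenEmbedding c)
    (g : I → ℝ) (hg : Continuous g) (hT : ∀ z t, (c z, t) ∈ T ↔ z ∈ curve (g t))
    {z : ℂ} {t : I} (hz : 0 < z.re) (ht : -1 < g t) : TransverseAt T (c z, t) := by
  let d : ℝ := (1 + g t) / 2
  have hd : 0 < d := by simp only [d]; linarith
  let sh := shear (fun x : ℝ × I => branch d (g x.2) x.1)
    ((continuous_branch hd).comp (f := fun x : ℝ × I => (g x.2, x.1)) (by fun_prop))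
  let O : Set (ℂ × I) := {x | 0 < x.1.re ∧ d < 1 + g x.2}
  have hO : IsOpen O :=
    IsOpen.and (isOpen_lt continuous_const (by fun_prop)) (isOpen_lt continuous_const (by fun_prop))
  let e₀ : OpenPartialHomeomorph (F × I) (ℂ × I) :=
    (hc.toOpenPartialHomeomorph c).symm.prod (OpenPartialHomeomorph.refl I)
  have key : ∀ w r, e₀ (c w, r) = (w, r) := fun w r =>
    Prod.ext (hc.toOpenPartialHomeomorph_left_inv c) rfl
  have hsrc : ∀ q : F × I, q ∈ e₀.source → ∃ w, q.1 = c w := fun q hq => by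
    obtain ⟨w, -, hw⟩ : q.1 ∈ c '' Set.univ := by
      have h := hq.1
      simpa using h
    exact ⟨w, hw.symm⟩
  have hsrc' : ∀ w r, (c w, r) ∈ e₀.source := fun w r => by
    refine ⟨?_, Set.mem_univ _⟩
    simp
  refine ⟨e₀.trans (sh.toOpenPartialHomeomorph.restrOpen O hO), ?_, ?_, ?_⟩
  · rw [OpenPartialHomeomorph.trans_source]
    refine ⟨hsrc' z t, ?_⟩
    rw [Set.mem_preimage, key]
    refine ⟨Set.mem_univ _, hz, ?_⟩
    simp only [d]; linarith
  · rintro ⟨q, r⟩ hq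
    rw [OpenPartialHomeomorph.trans_source] at hq
    obtain ⟨w, rfl : q = c w⟩ := hsrc _ hq.1
    have h2 := hq.2
    rw [Set.mem_preimage, key] at h2
    obtain ⟨-, h3, h4⟩ := h2
    rw [OpenPartialHomeomorph.coe_trans, Function.comp_apply, key, hT,
      mem_curve_iff_branch hd (le_of_lt h4) h3]
    rfl
  · rintro ⟨q, r⟩ hq
    rfl

theorem flatAt_of_re_pos {T : Set F} {c : ℂ → F} (hc : Topology.IsOpenEmbedding c)
    (hT : ∀ z, c z ∈ T ↔ z ∈ curve 1) {z : ℂ} (hz : 0 < z.re) : FlatAt T (c z) := by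
  let sh₀ := shear (fun x : ℝ × Unit => branch 1 1 x.1)
    ((continuous_branch one_pos).comp (f := fun x : ℝ × Unit => (1, x.1)) (by fun_prop))
  let sh : ℂ ≃ₜ ℝ × ℝ := (Homeomorph.prodPUnit ℂ).symm.trans
    (sh₀.trans ((Homeomorph.prodPUnit ℝ).prodCongr (Homeomorph.refl ℝ)))
  let O : Set ℂ := {x | 0 < x.re}
  have hO : IsOpen O := isOpen_lt continuous_const (by fun_prop)
  let e₀ : OpenPartialHomeomorph F ℂ := (hc.toOpenPartialHomeomorph c).symm
  have key : ∀ w, e₀ (c w) = w := fun w => hc.toOpenPartialHomeomorph_left_inv c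
  have hsrc : ∀ q : F, q ∈ e₀.source → ∃ w, q = c w := fun q hq => by
    obtain ⟨w, -, hw⟩ : q ∈ c '' Set.univ := by simpa [e₀] using hq
    exact ⟨w, hw.symm⟩
  have hsrc' : ∀ w, c w ∈ e₀.source := fun w => by simp [e₀]
  refine ⟨e₀.trans (sh.toOpenPartialHomeomorph.restrOpen O hO), ?_, ?_⟩
  · rw [OpenPartialHomeomorph.trans_source]
    refine ⟨hsrc' z, ?_⟩
    rw [Set.mem_preimage, key]
    exact ⟨Set.mem_univ _, hz⟩
  · intro q hq
    rw [OpenPartialHomeomorph.trans_source] at hq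
    obtain ⟨w, rfl⟩ := hsrc _ hq.1
    have h2 := hq.2
    rw [Set.mem_preimage, key] at h2
    rw [OpenPartialHomeomorph.coe_trans, Function.comp_apply, key, hT,
      mem_curve_iff_branch one_pos (by norm_num) h2.2]
    rfl

theorem TransverseAt.congr {T T' : Set (F × I)} {x : F × I} (h : TransverseAt T x)
    {O : Set (F × I)} (hO : IsOpen O) (hx : x ∈ O) (hTT : ∀ q ∈ O, q ∈ T' ↔ q ∈ T) :
    TransverseAt T' x := by
  obtain ⟨e, h1, h2, h3⟩ := h
  exact ⟨e.restrOpen O hO, ⟨h1, hx⟩, fun q hq => (hTT q hq.2).trans (h2 q hq.1),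
    fun q hq => h3 q hq.1⟩

theorem FlatAt.congr {T T' : Set F} {x : F} (h : FlatAt T x)
    {O : Set F} (hO : IsOpen O) (hx : x ∈ O) (hTT : ∀ q ∈ O, q ∈ T' ↔ q ∈ T) :
    FlatAt T' x := by
  obtain ⟨e, h1, h2⟩ := h
  exact ⟨e.restrOpen O hO, ⟨h1, hx⟩, fun q hq => (hTT q hq.2).trans (h2 q hq.1)⟩

theorem FlatAt.transverseAt {T : Set F} {p : F} (h : FlatAt T p) (t : I) :
    TransverseAt {x : F × I | x.1 ∈ T} (p, t) := by
  obtain ⟨e, h1, h2⟩ := h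
  let sw : (ℝ × ℝ) × I ≃ₜ (ℝ × I) × ℝ :=
    { toFun := fun x => ((x.1.1, x.2), x.1.2)
      invFun := fun x => ((x.1.1, x.2), x.1.2)
      left_inv := fun _ => rfl
      right_inv := fun _ => rfl
      continuous_toFun := by fun_prop
      continuous_invFun := by fun_prop }
  refine ⟨(e.prod (OpenPartialHomeomorph.refl I)).transHomeomorph sw, ⟨h1, Set.mem_univ _⟩,
    fun q hq => h2 q.1 hq.1, fun q hq => rfl⟩

/-- The points of the curve near which it is a graph over the imaginary axis or, after a quarter
turn, over the real axis. -/
theorem curve_cases {s : ℝ} {z : ℂ} (hz : z ∈ curve s) :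
    (z.re ≠ 0 ∧ -1 < s) ∨ (z.im ≠ 0 ∧ -1 < -s) ∨ (z = 0 ∧ s = 0) := by
  rw [curve, Set.mem_ofPred_eq] at hz
  by_cases hu : z.re = 0
  · by_cases hv : z.im = 0
    · right; right
      rw [hu, hv] at hz
      refine ⟨Complex.ext hu hv, ?_⟩
      norm_num at hz
      exact hz.symm
    · right; left
      refine ⟨hv, ?_⟩
      by_contra hs
      have hv2 : 0 < z.im ^ 2 := by positivity
      rw [hu] at hz
      have : 0 ≤ s * max 0 (1 - 0 ^ 2 - z.im ^ 2) :=
        mul_nonneg (by linarith) (le_max_left _ _)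
      nlinarith
  · by_cases hs : -1 < s
    · exact Or.inl ⟨hu, hs⟩
    · right; left
      refine ⟨fun hv => ?_, by linarith⟩
      have hu2 : 0 < z.re ^ 2 := by positivity
      rw [hv] at hz
      have : s * max 0 (1 - z.re ^ 2 - 0 ^ 2) ≤ 0 :=
        mul_nonpos_of_nonpos_of_nonneg (by linarith) (le_max_left _ _)
      nlinarith

/-- Precomposition of an open embedding of the plane with a quarter turn. -/
theorem isOpenEmbedding_rot {c : ℂ → F} (hc : Topology.IsOpenEmbedding c) (b : Bool) :
    Topology.IsOpenEmbedding fun z => c (quarterTurn b * z) :=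
  hc.comp (quarterTurnHomeo b).isOpenEmbedding

theorem isOpenEmbedding_neg {c : ℂ → F} (hc : Topology.IsOpenEmbedding c) :
    Topology.IsOpenEmbedding fun z => c (-z) :=
  hc.comp (Homeomorph.neg ℂ).isOpenEmbedding

theorem transverseAt_of_re_ne {T : Set (F × I)} {c : ℂ → F} (hc : Topology.IsOpenEmbedding c)
    (g : I → ℝ) (hg : Continuous g) (hT : ∀ z t, (c z, t) ∈ T ↔ z ∈ curve (g t))
    {z : ℂ} {t : I} (hz : z.re ≠ 0) (ht : -1 < g t) : TransverseAt T (c z, t) := by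
  rcases lt_or_gt_of_ne hz with h | h
  · have := transverseAt_of_re_pos (isOpenEmbedding_neg hc) g hg
      (fun z t => (hT _ t).trans (curve_neg _ z)) (z := -z) (t := t) (by simpa using h) ht
    simpa using this
  · exact transverseAt_of_re_pos hc g hg hT h ht

theorem transverseAt_of_chart {T : Set (F × I)} {c : ℂ → F} (hc : Topology.IsOpenEmbedding c)
    (g : I → ℝ) (hg : Continuous g) (hT : ∀ z t, (c z, t) ∈ T ↔ z ∈ curve (g t))
    {z : ℂ} {t : I} (hz : z ∈ curve (g t)) : TransverseAt T (c z, t) ∨ (z = 0 ∧ g t = 0) := by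
  rcases curve_cases hz with ⟨h1, h2⟩ | ⟨h1, h2⟩ | h
  · exact Or.inl (transverseAt_of_re_ne hc g hg hT h1 h2)
  · left
    have := transverseAt_of_re_ne (isOpenEmbedding_rot hc true) (fun t => -g t) hg.neg
      (fun z t => (hT _ t).trans (curve_rot _ z)) (z := -Complex.I * z) (t := t)
      (by simpa using h1) h2
    have hq : quarterTurn true * (-Complex.I * z) = z := by
      simp only [quarterTurn, if_true]
      linear_combination (-z) * Complex.I_sq
    simpa only [hq] using this
  · exact Or.inr h

theorem flatAt_of_re_ne {T : Set F} {c : ℂ → F} (hc : Topology.IsOpenEmbedding c)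
    (hT : ∀ z, c z ∈ T ↔ z ∈ curve 1) {z : ℂ} (hz : z.re ≠ 0) : FlatAt T (c z) := by
  rcases lt_or_gt_of_ne hz with h | h
  · have := flatAt_of_re_pos (isOpenEmbedding_neg hc)
      (fun z => (hT _).trans (curve_neg _ z)) (z := -z) (by simpa using h)
    simpa using this
  · exact flatAt_of_re_pos hc hT h

theorem flatAt_of_chart {T : Set F} {c : ℂ → F} (hc : Topology.IsOpenEmbedding c) (b : Bool)
    (hT : ∀ z, c z ∈ T ↔ z ∈ curve (level b)) {z : ℂ} (hz : z ∈ curve (level b)) :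
    FlatAt T (c z) := by
  cases b
  · simp only [level, Bool.false_eq_true, if_false] at hT hz
    rcases curve_cases hz with ⟨h1, -⟩ | ⟨-, h2⟩ | ⟨-, h2⟩
    · exact flatAt_of_re_ne hc hT h1
    · norm_num at h2
    · norm_num at h2
  · simp only [level, if_true] at hT hz
    rcases curve_cases hz with ⟨-, h2⟩ | ⟨h1, -⟩ | ⟨-, h2⟩
    · norm_num at h2
    · have := flatAt_of_re_ne (isOpenEmbedding_rot hc true)
        (fun z => (hT _).trans ((curve_rot _ z).trans (by rw [neg_neg])))
        (z := -Complex.I * z) (by simpa using h1)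
      have hq : quarterTurn true * (-Complex.I * z) = z := by
        simp only [quarterTurn, if_true]
        linear_combination (-z) * Complex.I_sq
      simpa only [hq] using this
    · norm_num at h2

theorem smoothing_flatAt [T2Space F] (D : Diagram S n) (ε : Fin n → Bool) {p : F}
    (hp : p ∈ D.smoothing ε) : FlatAt (D.smoothing ε) p := by
  rcases hp with ⟨h1, h2⟩ | ⟨i, z, rfl, hz⟩
  · obtain ⟨φ, hφ, ⟨z, rfl⟩, h3⟩ := D.flat p h1 h2
    have hflat : FlatAt (Set.range D.γ) (φ z) := by
      refine ⟨(hφ.toOpenPartialHomeomorph φ).symm.transHomeomorph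
        Complex.equivRealProdCLM.toHomeomorph, by simp, ?_⟩
      intro q hq
      obtain ⟨w, rfl⟩ : ∃ w, φ w = q := by simpa using hq
      have : (hφ.toOpenPartialHomeomorph φ).symm (φ w) = w :=
        hφ.toOpenPartialHomeomorph_left_inv φ
      rw [h3]
      simp [this]
    refine hflat.congr D.isClosed_core.isOpen_compl ?_
      fun q hq => mem_smoothing_of_notMem_core D ε hq
    intro hc
    obtain ⟨i, w, -, hw⟩ := Set.mem_iUnion.1 hc
    exact h2 i ⟨w, hw⟩
  · exact flatAt_of_chart (D.chart_open i) (ε i) (D.chart_mem_smoothing ε i) hz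

theorem smoothing_charts [T2Space F] (D : Diagram S n) (ε : Fin n → Bool) (p : D.smoothing ε) :
    ∃ e : OpenPartialHomeomorph (D.smoothing ε) ℝ, p ∈ e.source := by
  obtain ⟨e, h1, h2⟩ := D.smoothing_flatAt ε p.2
  obtain ⟨e', h3, -⟩ := chart_of_flat _ e h2 p h1
  exact ⟨e', h3⟩

/-- The chart of the interval at `0`. -/
def unitChart : OpenPartialHomeomorph I ℝ≥0 where
  toFun t := ⟨t, t.2.1⟩
  invFun y := Set.projIcc 0 1 zero_le_one (y : ℝ)
  source := {t | (t : ℝ) < 1}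
  target := {y | (y : ℝ) < 1}
  map_source' t ht := ht
  map_target' y hy := by
    show ((Set.projIcc (0 : ℝ) 1 zero_le_one (y : ℝ) : I) : ℝ) < 1
    rw [Set.projIcc_of_mem zero_le_one ⟨NNReal.coe_nonneg y, le_of_lt hy⟩]
    exact hy
  left_inv' t ht := Set.projIcc_val zero_le_one t
  right_inv' y hy := by
    apply NNReal.eq
    show ((Set.projIcc (0 : ℝ) 1 zero_le_one (y : ℝ) : I) : ℝ) = y
    rw [Set.projIcc_of_mem zero_le_one ⟨NNReal.coe_nonneg y, le_of_lt hy⟩]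
  open_source := isOpen_lt (by fun_prop) continuous_const
  open_target := isOpen_lt (by fun_prop) continuous_const
  continuousOn_toFun := (continuous_subtype_val.subtype_mk _).continuousOn
  continuousOn_invFun := (continuous_projIcc.comp NNReal.continuous_coe).continuousOn

theorem exists_unitChart (t : I) : ∃ e : OpenPartialHomeomorph I ℝ≥0, t ∈ e.source ∧
    ∀ s ∈ e.source, (s = 0 ∨ s = 1) ↔ e s = 0 := by
  have base : ∀ s ∈ unitChart.source, (s = 0 ∨ s = 1) ↔ unitChart s = 0 := fun s hs => by
    have h1 : (s : ℝ) < 1 := hs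
    have h2 : unitChart s = 0 ↔ (s : ℝ) = 0 := by
      rw [← NNReal.coe_eq_zero]; rfl
    rw [h2]
    constructor
    · rintro (rfl | rfl)
      · rfl
      · norm_num at h1
    · exact fun h => Or.inl (Subtype.ext h)
  by_cases ht : (t : ℝ) < 1
  · exact ⟨unitChart, ht, base⟩
  · have hσ : Continuous (σ : I → I) := unitInterval.continuous_symm
    let f : I ≃ₜ I := ⟨⟨σ, σ, unitInterval.symm_symm, unitInterval.symm_symm⟩, hσ, hσ⟩
    refine ⟨f.toOpenPartialHomeomorph.trans unitChart, ?_, fun s hs => ?_⟩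
    · rw [OpenPartialHomeomorph.trans_source]
      refine ⟨Set.mem_univ _, ?_⟩
      show ((σ t : I) : ℝ) < 1
      rw [unitInterval.coe_symm_eq]
      linarith
    · rw [OpenPartialHomeomorph.trans_source] at hs
      have h := base (σ s) hs.2
      show _ ↔ unitChart (σ s) = 0
      rw [← h, unitInterval.symm_eq_zero, unitInterval.symm_eq_one, or_comm]

/-- The inclusion of the open interval as a chart. -/
def innerChart : OpenPartialHomeomorph I ℝ where
  toFun t := t
  invFun y := Set.projIcc 0 1 zero_le_one y
  source := {t | 0 < (t : ℝ) ∧ (t : ℝ) < 1}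
  target := {y | 0 < y ∧ y < 1}
  map_source' t ht := ht
  map_target' y hy := by
    show 0 < ((Set.projIcc (0 : ℝ) 1 zero_le_one y : I) : ℝ) ∧
      ((Set.projIcc (0 : ℝ) 1 zero_le_one y : I) : ℝ) < 1
    rw [Set.projIcc_of_mem zero_le_one ⟨le_of_lt hy.1, le_of_lt hy.2⟩]
    exact hy
  left_inv' t ht := Set.projIcc_val zero_le_one t
  right_inv' y hy := by
    show ((Set.projIcc (0 : ℝ) 1 zero_le_one y : I) : ℝ) = y
    rw [Set.projIcc_of_mem zero_le_one ⟨le_of_lt hy.1, le_of_lt hy.2⟩]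
  open_source := IsOpen.and (isOpen_lt continuous_const (by fun_prop))
    (isOpen_lt (by fun_prop) continuous_const)
  open_target := IsOpen.and (isOpen_lt continuous_const (by fun_prop))
    (isOpen_lt (by fun_prop) continuous_const)
  continuousOn_toFun := continuous_subtype_val.continuousOn
  continuousOn_invFun := continuous_projIcc.continuousOn

/-- The line as an open subset of the half line, near `0`. -/
def shiftChart : OpenPartialHomeomorph ℝ ℝ≥0 where
  toFun v := (v + 1).toNNReal
  invFun y := y - 1
  source := {v | 0 < v + 1}
  target := {y | 0 < y}
  map_source' v hv := Real.toNNReal_pos.2 hv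
  map_target' y hy := by
    show 0 < (y : ℝ) - 1 + 1
    rw [sub_add_cancel]; exact hy
  left_inv' v hv := by
    have h : 0 < v + 1 := hv
    rw [Real.coe_toNNReal _ h.le]; ring
  right_inv' y hy := by simp
  open_source := isOpen_lt continuous_const (by fun_prop)
  open_target := isOpen_lt continuous_const continuous_id
  continuousOn_toFun := by fun_prop
  continuousOn_invFun := by fun_prop

/-- A subset of `F × [0,1]` has surface charts, with boundary over `0` and `1`, at its transverse
points. -/
theorem TransverseAt.chart {T : Set (F × I)} (x : T) (h : TransverseAt T x.1) :
    ∃ e : OpenPartialHomeomorph T (ℝ × ℝ≥0), x ∈ e.source ∧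
      ∀ q ∈ e.source, (q.1.2 = 0 ∨ q.1.2 = 1) ↔ (e q).2 = 0 := by
  obtain ⟨e, h1, h2, h3⟩ := h
  obtain ⟨e', h4, h5⟩ := chart_of_flat T e h2 x h1
  obtain ⟨u, h6, h7⟩ := exists_unitChart x.1.2
  have hsnd : ∀ q ∈ e'.source, (e' q).2 = q.1.2 := fun q hq => by
    rw [(h5 q hq).2, h3 _ (h5 q hq).1]
  refine ⟨e'.trans ((OpenPartialHomeomorph.refl ℝ).prod u), ?_, fun q hq => ?_⟩
  · rw [OpenPartialHomeomorph.trans_source]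
    refine ⟨h4, Set.mem_univ _, ?_⟩
    show (e' x).2 ∈ u.source
    rw [hsnd x h4]
    exact h6
  · rw [OpenPartialHomeomorph.trans_source] at hq
    have h8 : (e' q).2 ∈ u.source := hq.2.2
    show _ ↔ u (e' q).2 = 0
    rw [← h7 _ h8, hsnd q hq.1]

/-- The saddle as a graph over the disc. -/
def saddleHeight (z : ℂ) : ℝ :=
  (1 - (z.re ^ 2 - z.im ^ 2) / max (1 / 2) (1 - z.re ^ 2 - z.im ^ 2)) / 2

theorem continuous_saddleHeight : Continuous saddleHeight := by
  have h : ∀ z : ℂ, max (1 / 2) (1 - z.re ^ 2 - z.im ^ 2) ≠ 0 := fun z =>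
    (lt_of_lt_of_le (by norm_num) (le_max_left _ _)).ne'
  unfold saddleHeight
  fun_prop (disch := exact h _)

theorem mem_curve_iff_saddleHeight {z : ℂ} (hz : z.re ^ 2 + z.im ^ 2 < 1 / 2) (t : ℝ) :
    z ∈ curve (1 - 2 * t) ↔ t - saddleHeight z = 0 := by
  have h : 0 < 1 - z.re ^ 2 - z.im ^ 2 := by linarith
  rw [curve, Set.mem_ofPred_eq, saddleHeight, max_eq_right h.le, max_eq_right (by linarith)]
  constructor
  · intro h1
    rw [h1]; field_simp; ring
  · intro h1
    have h2 : 1 - 2 * t = (z.re ^ 2 - z.im ^ 2) / (1 - z.re ^ 2 - z.im ^ 2) := by linarith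
    rw [h2]; field_simp

/-- The shear `(z, t) ↦ ((re z, im z), t - saddleHeight z)`. -/
def saddleShear : ℂ × ℝ ≃ₜ (ℝ × ℝ) × ℝ where
  toFun x := ((x.1.re, x.1.im), x.2 - saddleHeight x.1)
  invFun y := (⟨y.1.1, y.1.2⟩, y.2 + saddleHeight ⟨y.1.1, y.1.2⟩)
  left_inv x := by simp
  right_inv y := by simp
  continuous_toFun := by
    have := continuous_saddleHeight
    fun_prop
  continuous_invFun := by
    have h : Continuous fun y : (ℝ × ℝ) × ℝ => (⟨y.1.1, y.1.2⟩ : ℂ) :=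
      Complex.equivRealProdCLM.symm.continuous.comp continuous_fst
    exact h.prodMk (continuous_snd.add (continuous_saddleHeight.comp h))

theorem saddlePoint_chart {T : Set (F × I)} {c : ℂ → F} (hc : Topology.IsOpenEmbedding c)
    (hT : ∀ z (t : I), (c z, t) ∈ T ↔ z ∈ curve (1 - 2 * (t : ℝ))) {t : I}
    (ht : 1 - 2 * (t : ℝ) = 0) (x : T) (hx : x.1 = (c 0, t)) :
    ∃ e : OpenPartialHomeomorph T (ℝ × ℝ≥0), x ∈ e.source ∧
      ∀ q ∈ e.source, (q.1.2 = 0 ∨ q.1.2 = 1) ↔ (e q).2 = 0 := by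
  let O : Set (ℂ × ℝ) := {x | x.1.re ^ 2 + x.1.im ^ 2 < 1 / 2}
  have hO : IsOpen O := isOpen_lt (by fun_prop) continuous_const
  let e₀ : OpenPartialHomeomorph (F × I) (ℂ × ℝ) :=
    (hc.toOpenPartialHomeomorph c).symm.prod innerChart
  have key : ∀ w (r : I), e₀ (c w, r) = (w, (r : ℝ)) := fun w r =>
    Prod.ext (hc.toOpenPartialHomeomorph_left_inv c) rfl
  have hsrc : ∀ q : F × I, q ∈ e₀.source → ∃ w, q.1 = c w := fun q hq => by
    obtain ⟨w, -, hw⟩ : q.1 ∈ c '' Set.univ := by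
      have h := hq.1
      simpa using h
    exact ⟨w, hw.symm⟩
  have hsrc' : ∀ w (r : I), 0 < (r : ℝ) ∧ (r : ℝ) < 1 → (c w, r) ∈ e₀.source := fun w r hr => by
    refine ⟨?_, hr⟩
    simp
  let e₁ := e₀.trans (saddleShear.toOpenPartialHomeomorph.restrOpen O hO)
  have hflat : ∀ q ∈ e₁.source, q ∈ T ↔ (e₁ q).2 = 0 := by
    rintro ⟨q, r⟩ hq
    rw [OpenPartialHomeomorph.trans_source] at hq
    obtain ⟨w, rfl : q = c w⟩ := hsrc _ hq.1
    have h2 := hq.2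
    rw [Set.mem_preimage, key] at h2
    rw [OpenPartialHomeomorph.coe_trans, Function.comp_apply, key, hT,
      mem_curve_iff_saddleHeight h2.2]
    rfl
  have hx1 : x.1 ∈ e₁.source := by
    rw [hx, OpenPartialHomeomorph.trans_source]
    refine ⟨hsrc' 0 t ⟨by linarith, by linarith⟩, ?_⟩
    rw [Set.mem_preimage, key]
    refine ⟨Set.mem_univ _, ?_⟩
    show (0 : ℂ).re ^ 2 + (0 : ℂ).im ^ 2 < 1 / 2
    norm_num
  obtain ⟨e', h4, h5⟩ := chart_of_flat T e₁ hflat x hx1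
  refine ⟨e'.trans ((OpenPartialHomeomorph.refl ℝ).prod shiftChart), ?_, fun q hq => ?_⟩
  · rw [OpenPartialHomeomorph.trans_source]
    refine ⟨h4, Set.mem_univ _, ?_⟩
    show 0 < (e' x).2 + 1
    rw [(h5 x h4).2, hx]
    show 0 < ((e₀ (c 0, t)).1).im + 1
    rw [key]
    norm_num
  · rw [OpenPartialHomeomorph.trans_source] at hq
    have h6 : q.1 ∈ e₁.source := (h5 q hq.1).1
    have h7 : 0 < ((q.1.2 : I) : ℝ) ∧ ((q.1.2 : I) : ℝ) < 1 := h6.1.2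
    have h8 : 0 < (e' q).2 + 1 := hq.2.2
    constructor
    · rintro (h | h)
      · rw [h] at h7; norm_num at h7
      · rw [h] at h7; norm_num at h7
    · intro h
      have h9 : ((e' q).2 + 1).toNNReal = 0 := h
      exact absurd (Real.toNNReal_eq_zero.1 h9) (not_le.2 h8)

theorem saddle_charts [T2Space F] (D : Diagram S n) (ε : Fin n → Bool) (j : Fin n)
    (x : D.saddleSet ε j) : ∃ e : OpenPartialHomeomorph (D.saddleSet ε j) (ℝ × ℝ≥0),
      x ∈ e.source ∧ ∀ q ∈ e.source, (q.1.2 = 0 ∨ q.1.2 = 1) ↔ (e q).2 = 0 := by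
  obtain ⟨⟨p, t⟩, hx⟩ := x
  by_cases hc : p ∈ D.chart j '' Metric.closedBall 0 1
  · obtain ⟨z, -, rfl⟩ := hc
    rcases transverseAt_of_chart (D.chart_open j) (fun t : I => 1 - 2 * (t : ℝ)) (by fun_prop)
      (D.chart_mem_saddleSet ε j) ((D.chart_mem_saddleSet ε j z t).1 hx) with h | ⟨rfl, h⟩
    · exact h.chart ⟨_, hx⟩
    · exact saddlePoint_chart (D.chart_open j) (D.chart_mem_saddleSet ε j) h ⟨_, hx⟩ rfl
  · have hK : IsClosed (D.chart j '' Metric.closedBall 0 1) :=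
      ((isCompact_closedBall (0 : ℂ) 1).image (D.chart_open j).continuous).isClosed
    have hp := (mem_saddleSet_of_notMem D ε j t hc).1 hx
    refine TransverseAt.chart ⟨_, hx⟩ ?_
    refine ((D.smoothing_flatAt ε hp).transverseAt t).congr
      (O := {y : F × I | y.1 ∉ D.chart j '' Metric.closedBall 0 1})
      (hK.isOpen_compl.preimage continuous_fst) hc ?_
    rintro ⟨q, r⟩ hq
    exact mem_saddleSet_of_notMem D ε j r hq

end Diagram

/-! ### The complex of a link diagram -/

open Diagram

variable {S : OrientedSurface F} {n : ℕ} {X : Type*} [TopologicalSpace X] {x₀ : X}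

/-- A choice of one base point on every circle of every smoothing of `D`, at points which `h` sends
to `x₀`. -/
structure BasePoints (D : Diagram S n) (h : C(F, X)) (x₀ : X) where
  base : ∀ ε : Fin n → Bool, Set (D.smoothing ε)
  base_unique : ∀ (ε : Fin n → Bool) (p : D.smoothing ε),
    ∃! b, b ∈ base ε ∧ b ∈ connectedComponent p
  map_base : ∀ ε, ∀ b ∈ base ε, h b.1 = x₀

/-- `ε'` is obtained from `ε` by changing the `j`-th entry from `0` to `1`. -/
def IsEdge (ε ε' : Fin n → Bool) (j : Fin n) : Prop :=
  ε j = false ∧ ε' = Function.update ε j true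

instance (ε ε' : Fin n → Bool) (j : Fin n) : Decidable (IsEdge ε ε' j) :=
  inferInstanceAs (Decidable (_ ∧ _))

/-- The number `|ε|` of ones in `ε`. -/
def weight (ε : Fin n → Bool) : ℕ := (Finset.univ.filter fun i => ε i = true).card

/-- The number of ones of `ε` in front of the `j`-th entry. -/
def onesBefore (ε : Fin n → Bool) (j : Fin n) : ℕ :=
  (Finset.univ.filter fun i => i < j ∧ ε i = true).card

namespace Diagram

theorem mem_saddle_zero (D : Diagram S n) {ε ε' : Fin n → Bool} {j : Fin n} (hj : IsEdge ε ε' j) (p : F) :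
    (p, (0 : I)) ∈ D.saddleSet ε j ↔ p ∈ D.smoothing ε := by
  by_cases hc : p ∈ Set.range (D.chart j)
  · obtain ⟨z, rfl⟩ := hc
    rw [chart_mem_saddleSet, chart_mem_smoothing, hj.1]
    simp [level]
  · exact mem_saddleSet_of_notMem D ε j 0 fun ⟨z, _, hz⟩ => hc ⟨z, hz⟩

theorem mem_saddle_one (D : Diagram S n) {ε ε' : Fin n → Bool} {j : Fin n} (hj : IsEdge ε ε' j) (p : F) :
    (p, (1 : I)) ∈ D.saddleSet ε j ↔ p ∈ D.smoothing ε' := by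
  obtain ⟨h0, rfl⟩ := hj
  by_cases hc : ∃ i, p ∈ Set.range (D.chart i)
  · obtain ⟨i, z, rfl⟩ := hc
    by_cases hij : i = j
    · subst hij
      rw [chart_mem_saddleSet, chart_mem_smoothing, Function.update_self]
      norm_num [level]
    · rw [mem_saddleSet_of_notMem D ε j 1 (fun ⟨w, _, hw⟩ => hij (D.chart_inj hw).1.symm),
        chart_mem_smoothing, chart_mem_smoothing, Function.update_of_ne hij]
  · have hcore : p ∉ D.core := fun hp => by
      obtain ⟨i, w, -, hw⟩ := Set.mem_iUnion.1 hp
      exact hc ⟨i, w, hw⟩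
    rw [mem_saddleSet_of_notMem D ε j 1 (fun ⟨w, _, hw⟩ => hc ⟨j, w, hw⟩),
      mem_smoothing_of_notMem_core D ε hcore, mem_smoothing_of_notMem_core D _ hcore]

end Diagram

namespace BasePoints

variable [T2Space F] [CompactSpace F] {D : Diagram S n} {h : C(F, X)}

/-- The smoothing `D_ε` as an `X`-manifold. -/
def mfd (b : BasePoints D h x₀) (ε : Fin n → Bool) : XMfd X x₀ where
  carrier := D.smoothing ε
  compact := isCompact_iff_compactSpace.1 (D.isClosed_smoothing ε).isCompact
  charts := D.smoothing_charts ε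
  base := b.base ε
  base_unique := b.base_unique ε
  map := h.comp ⟨Subtype.val, continuous_subtype_val⟩
  map_base := b.map_base ε

/-- The cobordism `Σ_{ε → ε'}` in `F × [0,1]` from `D_ε` to `D_ε'`. Its characteristic map is `h`
composed with the projection to `F`. -/
def saddle (b : BasePoints D h x₀) {ε ε' : Fin n → Bool} {j : Fin n} (hj : IsEdge ε ε' j) :
    XCob (b.mfd ε) (b.mfd ε') where
  carrier := D.saddleSet ε j
  compact := isCompact_iff_compactSpace.1 (D.isClosed_saddleSet ε j).isCompact
  bot := ⟨fun p : D.smoothing ε => ⟨(p.1, 0), (D.mem_saddle_zero hj p.1).2 p.2⟩, by fun_prop⟩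
  topm := ⟨fun p : D.smoothing ε' => ⟨(p.1, 1), (D.mem_saddle_one hj p.1).2 p.2⟩, by fun_prop⟩
  bot_injective p q hpq := Subtype.ext (congrArg (fun x => x.1.1) hpq)
  topm_injective p q hpq := Subtype.ext (congrArg (fun x => x.1.1) hpq)
  disjoint := by
    rw [Set.disjoint_left]
    rintro _ ⟨p, rfl⟩ ⟨q, hq⟩
    have h1 : (1 : I) = 0 := congrArg (fun x => x.1.2) hq
    exact one_ne_zero h1
  surface x := by
    obtain ⟨e, h1, h2⟩ := D.saddle_charts ε j x
    refine ⟨e, h1, fun q hq => (Iff.trans ?_ (h2 q hq))⟩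
    constructor
    · rintro (⟨p, rfl⟩ | ⟨p, rfl⟩)
      · exact Or.inl rfl
      · exact Or.inr rfl
    · obtain ⟨⟨q, t⟩, hqt⟩ := q
      rintro (h3 | h3)
      · obtain rfl : t = 0 := h3
        exact Or.inl ⟨(⟨q, (D.mem_saddle_zero hj q).1 hqt⟩ : D.smoothing ε), rfl⟩
      · obtain rfl : t = 1 := h3
        exact Or.inr ⟨(⟨q, (D.mem_saddle_one hj q).1 hqt⟩ : D.smoothing ε'), rfl⟩
  map := h.comp ⟨fun x => x.1.1, by fun_prop⟩
  map_bot _ := rfl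
  map_topm _ := rfl

end BasePoints

namespace HQFT

variable [T2Space F] [CompactSpace F] {D : Diagram S n} {h : C(F, X)} {R : Type*} [CommRing R]

/-- `C^i(F, D)`, the direct sum of the modules `A(D_ε)` over all `ε` with `|ε| = i + n₋`. -/
abbrev Cochain (A : HQFT R X x₀) (b : BasePoints D h x₀) (i : ℤ) : Type _ :=
  (ε : {ε : Fin n → Bool // (weight ε : ℤ) = i + D.negCrossings}) → A.obj (b.mfd ε.1)

/-- The matrix entry `A(D_ε) → A(D_ε')` of the differential. -/
def entry (A : HQFT R X x₀) (b : BasePoints D h x₀) (ε ε' : Fin n → Bool) :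
    A.obj (b.mfd ε) →ₗ[R] A.obj (b.mfd ε') :=
  ∑ j : Fin n, if hj : IsEdge ε ε' j then (-1 : R) ^ onesBefore ε j • A.τ (b.saddle hj) else 0

/-- The differential `C^i → C^j`, for `j = i + 1`. -/
def d (A : HQFT R X x₀) (b : BasePoints D h x₀) (i j : ℤ) : A.Cochain b i →ₗ[R] A.Cochain b j :=
  LinearMap.pi fun ε' =>
    ∑ ε : {ε : Fin n → Bool // (weight ε : ℤ) = i + D.negCrossings},
      A.entry b ε.1 ε'.1 ∘ₗ LinearMap.proj ε

/-- `H^i_{(A,τ)}(F, D) = ker d^i / im d^{i-1}`. -/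
abbrev Homology (A : HQFT R X x₀) (b : BasePoints D h x₀) (i : ℤ) : Type _ :=
  LinearMap.ker (A.d b i (i + 1)) ⧸
    (LinearMap.range (A.d b (i - 1) i)).submoduleOf (LinearMap.ker (A.d b i (i + 1)))

end HQFT

end LinkHQFT

end

open LinkHQFT

open scoped TensorProduct NNReal unitInterval Topology

noncomputable section

namespace LinkHQFT

/-! ### Products with the interval and collars -/

/-! The duality is already present in the field theory. Let `M` and `M'` be manifolds over `X` whose
underlying spaces are identified by a homeomorphism over `X`. Bending the cylinder over `M` until
both ends lie at the bottom gives a cobordism from `M ⊔ M'` to `∅`, hence a bilinear form on `A(M) ×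
A(M')`. The map of a cobordism to `X` obeys no base point condition of its own, so the base points
of `M` and `M'` may be unrelated. This is why the base points of `D` and of its mirror image can be
chosen independently.

Two facts about this form carry the proof. It is nondegenerate (`pairing_nondegenerate`): a zigzag
of bent cylinders straightens to a cylinder, which acts as the identity, so an element orthogonal to
everything must vanish. Moreover a cobordism and the same surface turned upside down act by adjoint
maps (`pairing_adjoint`): both sides evaluate one surface, with its whole boundary moved to the
bottom. Collars are attached so that all these gluings are literal.

Changing a crossing exchanges its two smoothings. Hence the smoothing of `D` at a vertex `ε` of the
cube and the smoothing of the mirror diagram at the opposite vertex are the same subset of `F`, and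
reflecting `[0,1]` turns the saddle of an edge into the saddle of the opposite edge of the mirror
cube (`mem_mirror_saddleSet`). So corresponding edge maps are adjoint. Opposite vertices have
weights with sum `n`, and so do the numbers of negative crossings of the two diagrams; therefore
degree `i` is paired with degree `-i`. The signs of an edge and of its opposite differ by `(-1)^j`,
where `j` is the number of entries in front of the changed one, and weighting the pairing at each
vertex by `vertexSign` absorbs this.

The complex of the mirror diagram is thus the dual of the complex of `D`, with transposed
differentials. Over a field, finite-dimensional dual sequences have homology of equal dimension
(`nonempty_homology_equiv_of_pairing`), and the isomorphism comes from this equality. -/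

theorem isSurfaceWithBoundary_prod {M : Type} [TopologicalSpace M]
    (h : ∀ p : M, ∃ e : OpenPartialHomeomorph M ℝ, p ∈ e.source) :
    IsSurfaceWithBoundary (M × I) {x | x.2 = 0 ∨ x.2 = 1} := fun x => by
  obtain ⟨e, he⟩ := h x.1
  obtain ⟨u, hu, hu'⟩ := Diagram.exists_unitChart x.2
  exact ⟨e.prod u, ⟨he, hu⟩, fun q hq => hu' q.2 hq.2⟩

theorem IsSurfaceWithBoundary.sum {W W' : Type} [TopologicalSpace W] [TopologicalSpace W']
    {B : Set W} {B' : Set W'} (h : IsSurfaceWithBoundary W B) (h' : IsSurfaceWithBoundary W' B') :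
    IsSurfaceWithBoundary (W ⊕ W') {x | Sum.elim (· ∈ B) (· ∈ B') x} := by
  rintro (p | p)
  · obtain ⟨e, he, hB⟩ := h p
    refine ⟨e.lift_openEmbedding Topology.IsOpenEmbedding.inl, ?_, ?_⟩
    · rw [OpenPartialHomeomorph.lift_openEmbedding_source]; exact ⟨p, he, rfl⟩
    · rw [OpenPartialHomeomorph.lift_openEmbedding_source]
      rintro _ ⟨q, hq, rfl⟩
      rw [OpenPartialHomeomorph.lift_openEmbedding_apply]
      exact hB q hq
  · obtain ⟨e, he, hB⟩ := h' p
    refine ⟨e.lift_openEmbedding Topology.IsOpenEmbedding.inr, ?_, ?_⟩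
    · rw [OpenPartialHomeomorph.lift_openEmbedding_source]; exact ⟨p, he, rfl⟩
    · rw [OpenPartialHomeomorph.lift_openEmbedding_source]
      rintro _ ⟨q, hq, rfl⟩
      rw [OpenPartialHomeomorph.lift_openEmbedding_apply]
      exact hB q hq

/-- The space `W` with a collar `B × [0,1]` attached along `B × {1}`. -/
abbrev Collar {W : Type} (B : Set W) : Type := ({x | x.2 = 1 ∨ x.1 ∈ B} : Set (W × I))

/-- The chart of a collared space near a point of `W` away from the collar. -/
def collarOuterChart {W : Type} [TopologicalSpace W] {B : Set W} {H : Type*} [TopologicalSpace H]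
    (hB : IsClosed B) (e : OpenPartialHomeomorph W H) : OpenPartialHomeomorph (Collar B) H where
  toFun q := e q.1.1
  invFun y := ⟨(e.symm y, 1), Or.inl rfl⟩
  source := {q | q.1.1 ∈ e.source ∧ q.1.1 ∉ B}
  target := e.target ∩ e.symm ⁻¹' Bᶜ
  map_source' q hq := ⟨e.map_source hq.1, by
    rw [Set.mem_preimage, e.left_inv hq.1]; exact hq.2⟩
  map_target' y hy := ⟨e.map_target hy.1, hy.2⟩
  left_inv' q hq := Subtype.ext (Prod.ext (e.left_inv hq.1) (q.2.resolve_right hq.2).symm)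
  right_inv' y hy := e.right_inv hy.1
  open_source := (e.open_source.inter hB.isOpen_compl).preimage (by fun_prop)
  open_target := e.symm.isOpen_inter_preimage hB.isOpen_compl
  continuousOn_toFun := e.continuousOn.comp (by fun_prop) fun q hq => hq.1
  continuousOn_invFun := by
    rw [Topology.IsInducing.subtypeVal.continuousOn_iff]
    exact (e.continuousOn_symm.mono Set.inter_subset_left).prodMk continuousOn_const

/-- A surface with a collar attached along a part `B` of its boundary is a surface. -/
theorem IsSurfaceWithBoundary.collar {W : Type} [TopologicalSpace W] {B B' : Set W}
    (hB : IsClosed B) (hB' : IsClosed B') (hd : Disjoint B B')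
    (h : IsSurfaceWithBoundary W (B ∪ B')) :
    IsSurfaceWithBoundary (Collar B) {x | x.1.2 = 0 ∨ x.1.2 = 1 ∧ x.1.1 ∈ B'} := by
  classical
  intro p
  obtain ⟨e, he, hb⟩ := h p.1.1
  -- Near `B'` there is no collar and the chart of `W` is kept. Elsewhere the new height is the old
  -- height plus the collar coordinate: `W`, which sits at collar coordinate `1`, is lifted by `1`,
  -- and the collar over an edge point fills the heights from `0` to `1`.
  by_cases hp : p.1.1 ∈ B'
  · refine ⟨collarOuterChart hB e, ⟨he, fun hp' => Set.disjoint_left.1 hd hp' hp⟩, ?_⟩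
    rintro q ⟨h1, h2⟩
    have h3 : q.1.2 = 1 := q.2.resolve_right h2
    have h4 := hb _ h1
    show q.1.2 = 0 ∨ q.1.2 = 1 ∧ q.1.1 ∈ B' ↔ (e q.1.1).2 = 0
    rw [← h4, h3]
    simp [h2]
  -- Subtraction in `ℝ≥0` is truncated, so a height below `1` is sent to the edge point beneath it.
  -- That point lies in `B`, because `B'` is excluded.
  have hmem : ∀ y : ℝ × ℝ≥0, (y.1, y.2 - 1) ∈ e.target → e.symm (y.1, y.2 - 1) ∉ B' →
      y.2 < 1 → e.symm (y.1, y.2 - 1) ∈ B := fun y h1 h2 h3 =>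
    ((hb _ (e.map_target h1)).2 (by
      rw [e.right_inv h1]; exact tsub_eq_zero_of_le h3.le)).resolve_right h2
  let v : ℝ × ℝ≥0 → I := fun y => ⟨min (y.2 : ℝ) 1, le_min y.2.2 zero_le_one, min_le_right _ _⟩
  have hv : Continuous v := by fun_prop
  let u : I → ℝ≥0 := fun s => ⟨s, s.2.1⟩
  have hu : Continuous u := by fun_prop
  have hmem' : ∀ y : ℝ × ℝ≥0, (y.1, y.2 - 1) ∈ e.target → e.symm (y.1, y.2 - 1) ∉ B' →
      v y = 1 ∨ e.symm (y.1, y.2 - 1) ∈ B := fun y h1 h2 => by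
    rcases lt_or_ge y.2 1 with h3 | h3
    · exact Or.inr (hmem y h1 h2 h3)
    · exact Or.inl (Subtype.ext (min_eq_right (by exact_mod_cast h3)))
  let T : Set (ℝ × ℝ≥0) :=
    (fun y : ℝ × ℝ≥0 => (y.1, y.2 - 1)) ⁻¹' (e.target ∩ e.symm ⁻¹' B'ᶜ)
  -- The default value `p` is never taken on `T`.
  let g : ℝ × ℝ≥0 → Collar B := fun y =>
    if hy : v y = 1 ∨ e.symm (y.1, y.2 - 1) ∈ B then ⟨(e.symm (y.1, y.2 - 1), v y), hy⟩ else p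
  have hg : ∀ y ∈ T, (g y).1 = (e.symm (y.1, y.2 - 1), v y) := fun y hy => by
    simp only [g, dif_pos (hmem' y hy.1 hy.2)]
  -- Either the collar coordinate is `1` or the height in `e` is `0`. In both cases the sum
  -- determines its two summands: truncated subtraction of `1` recovers the height, the minimum with
  -- `1` recovers the collar coordinate.
  have key : ∀ q : Collar B, q.1.1 ∈ e.source → q.1.1 ∉ B' →
      (e q.1.1).2 + u q.1.2 - 1 = (e q.1.1).2 ∧ v ((e q.1.1).1, (e q.1.1).2 + u q.1.2) = q.1.2 := by
    rintro ⟨⟨w, s⟩, hw⟩ (h1 : w ∈ _) (h2 : w ∉ _)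
    rcases hw with h0 | hw
    · obtain rfl : s = 1 := h0
      have : u 1 = 1 := rfl
      refine ⟨by simp [this], Subtype.ext (min_eq_right ?_)⟩
      simp [this]
    · have h3 : (e w).2 = 0 := (hb w h1).1 (Or.inl hw)
      refine ⟨?_, Subtype.ext ?_⟩
      · simp only [h3, zero_add]
        exact tsub_eq_zero_of_le s.2.2
      · show min (((e w).2 + u s : ℝ≥0) : ℝ) 1 = s
        rw [h3, zero_add]
        exact min_eq_left s.2.2
  refine ⟨{ toFun := fun q => ((e q.1.1).1, (e q.1.1).2 + u q.1.2)
            invFun := g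
            source := {q | q.1.1 ∈ e.source ∩ B'ᶜ}
            target := T
            map_source' := ?_
            map_target' := ?_
            left_inv' := ?_
            right_inv' := ?_
            open_source := (e.open_source.inter hB'.isOpen_compl).preimage (by fun_prop)
            open_target := (e.symm.isOpen_inter_preimage hB'.isOpen_compl).preimage (by fun_prop)
            continuousOn_toFun := ?_
            continuousOn_invFun := ?_ }, ⟨he, hp⟩, ?_⟩
  · intro q hq
    show ((e q.1.1).1, (e q.1.1).2 + u q.1.2 - 1) ∈ e.target ∩ e.symm ⁻¹' B'ᶜ
    rw [(key q hq.1 hq.2).1]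
    exact ⟨e.map_source hq.1, by rw [Set.mem_preimage, Prod.mk.eta, e.left_inv hq.1]; exact hq.2⟩
  · intro y hy
    show (g y).1.1 ∈ e.source ∩ B'ᶜ
    rw [hg y hy]
    exact ⟨e.map_target hy.1, hy.2⟩
  · intro q hq
    have h1 := key q hq.1 hq.2
    apply Subtype.ext
    rw [hg]
    · simp only [h1.1, h1.2, Prod.mk.eta, e.left_inv hq.1]
    · show ((e q.1.1).1, (e q.1.1).2 + u q.1.2 - 1) ∈ e.target ∩ e.symm ⁻¹' B'ᶜ
      rw [h1.1]
      exact ⟨e.map_source hq.1, by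
        rw [Set.mem_preimage, Prod.mk.eta, e.left_inv hq.1]; exact hq.2⟩
  · intro y hy
    simp only [hg y hy, e.right_inv hy.1]
    refine Prod.ext rfl ?_
    apply NNReal.eq
    show ((y.2 - 1 : ℝ≥0) : ℝ) + min (y.2 : ℝ) 1 = y.2
    rcases le_total y.2 1 with h1 | h1
    · rw [tsub_eq_zero_of_le h1, min_eq_left (by exact_mod_cast h1)]; simp
    · rw [NNReal.coe_sub h1, min_eq_right (by exact_mod_cast h1)]; simp
  · have h1 : ContinuousOn (fun q : Collar B => e q.1.1) {q | q.1.1 ∈ e.source ∩ B'ᶜ} :=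
      e.continuousOn.comp (by fun_prop) fun q hq => hq.1
    have h2 : Continuous fun q : Collar B => u q.1.2 := by fun_prop
    exact h1.fst.prodMk (h1.snd.add h2.continuousOn)
  · rw [Topology.IsInducing.subtypeVal.continuousOn_iff]
    refine ContinuousOn.congr (f := fun y : ℝ × ℝ≥0 => (e.symm (y.1, y.2 - 1), v y)) ?_ hg
    exact (e.continuousOn_symm.comp (f := fun y : ℝ × ℝ≥0 => (y.1, y.2 - 1))
      (by fun_prop) fun y hy => hy.1).prodMk hv.continuousOn
  · rintro q ⟨h1, h2⟩
    have h3 : q.1.1 ∉ B' := h2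
    show q.1.2 = 0 ∨ q.1.2 = 1 ∧ q.1.1 ∈ B' ↔ (e q.1.1).2 + u q.1.2 = 0
    have h4 : u q.1.2 = 0 ↔ q.1.2 = 0 := by
      rw [← NNReal.coe_eq_zero]; exact ⟨fun h => Subtype.ext h, fun h => by rw [h]; rfl⟩
    rw [add_eq_zero, h4, ← hb _ h1]
    simp only [h3, and_false, or_false, Set.mem_union]
    refine ⟨fun h5 => ⟨q.2.resolve_left fun h6 => ?_, h5⟩, fun h5 => h5.2⟩
    rw [h6] at h5
    exact one_ne_zero h5

theorem Collar.isClosed {W : Type} [TopologicalSpace W] {B : Set W} (hB : IsClosed B) :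
    IsClosed ({x | x.2 = 1 ∨ x.1 ∈ B} : Set (W × I)) :=
  (isClosed_eq continuous_snd continuous_const).union (hB.preimage continuous_fst)

/-- The affine map of the interval with given values at the end points. -/
def affineI (c d : I) : C(I, I) where
  toFun s := ⟨(1 - s) * c + s * d,
    add_nonneg (mul_nonneg (sub_nonneg.2 s.2.2) c.2.1) (mul_nonneg s.2.1 d.2.1), by
      nlinarith [s.2.1, s.2.2, c.2.2, d.2.2, mul_nonneg (sub_nonneg.2 s.2.2) (sub_nonneg.2 c.2.2),
        mul_nonneg s.2.1 (sub_nonneg.2 d.2.2)]⟩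
  continuous_toFun := by fun_prop

theorem coe_affineI (c d s : I) : (affineI c d s : ℝ) = (1 - s) * c + s * d := rfl


/-! ### Constructions of cobordisms -/

section

variable {X : Type*} [TopologicalSpace X] {x₀ : X}

/-- The identity `X`-homeomorphism. -/
def XHomeo.refl (M : XMfd X x₀) : XHomeo M M := ⟨Homeomorph.refl _, fun _ => Iff.rfl, fun _ => rfl⟩

namespace XCob

variable {M N M' N' : XMfd X x₀}

theorem isClosed_range_bot (W : XCob M N) : IsClosed (Set.range W.bot) :=
  (isCompact_range W.bot.continuous).isClosed

theorem isClosed_range_topm (W : XCob M N) : IsClosed (Set.range W.topm) :=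
  (isCompact_range W.topm.continuous).isClosed

theorem bot_ne_topm (W : XCob M N) (m : M.carrier) (n : N.carrier) : W.bot m ≠ W.topm n := fun h =>
  Set.disjoint_left.1 W.disjoint ⟨m, rfl⟩ ⟨n, h.symm⟩

/-- The cobordism turned upside down. -/
def reverse (W : XCob M N) : XCob N M where
  carrier := W.carrier
  bot := W.topm
  topm := W.bot
  bot_injective := W.topm_injective
  topm_injective := W.bot_injective
  disjoint := W.disjoint.symm
  surface := by rw [Set.union_comm]; exact W.surface
  map := W.map
  map_bot := W.map_topm
  map_topm := W.map_bot

/-- The cobordism with reparametrized bottom and top. -/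
def reindex (W : XCob M N) (f : XHomeo M' M) (g : XHomeo N' N) : XCob M' N' where
  carrier := W.carrier
  bot := W.bot.comp f.homeo
  topm := W.topm.comp g.homeo
  bot_injective := W.bot_injective.comp f.homeo.injective
  topm_injective := W.topm_injective.comp g.homeo.injective
  disjoint := W.disjoint.mono (Set.range_comp_subset_range f.homeo W.bot)
    (Set.range_comp_subset_range g.homeo W.topm)
  surface := by
    have h1 : Set.range (W.bot.comp (f.homeo : C(M'.carrier, M.carrier))) = Set.range W.bot :=
      f.homeo.surjective.range_comp W.bot
    have h2 : Set.range (W.topm.comp (g.homeo : C(N'.carrier, N.carrier))) = Set.range W.topm :=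
      g.homeo.surjective.range_comp W.topm
    rw [h1, h2]
    exact W.surface
  map := W.map
  map_bot p := (W.map_bot _).trans (f.map_eq p)
  map_topm p := (W.map_topm _).trans (g.map_eq p)

/-- The disjoint union of cobordisms. -/
def sum (W : XCob M N) (W' : XCob M' N') : XCob (M.sum M') (N.sum N') where
  carrier := W.carrier ⊕ W'.carrier
  bot := ⟨Sum.map W.bot W'.bot, W.bot.continuous.sumMap W'.bot.continuous⟩
  topm := ⟨Sum.map W.topm W'.topm, W.topm.continuous.sumMap W'.topm.continuous⟩
  bot_injective := Sum.map_injective.2 ⟨W.bot_injective, W'.bot_injective⟩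
  topm_injective := Sum.map_injective.2 ⟨W.topm_injective, W'.topm_injective⟩
  disjoint := by
    rw [Set.disjoint_left]
    rintro _ ⟨p | p, rfl⟩ ⟨q | q, hq⟩
    · exact W.bot_ne_topm p q (Sum.inl_injective hq).symm
    · cases hq
    · cases hq
    · exact W'.bot_ne_topm p q (Sum.inr_injective hq).symm
  surface := by
    convert W.surface.sum W'.surface using 1
    ext x
    constructor
    · rintro (⟨p | p, rfl⟩ | ⟨p | p, rfl⟩)
      · exact Or.inl ⟨p, rfl⟩
      · exact Or.inl ⟨p, rfl⟩
      · exact Or.inr ⟨p, rfl⟩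
      · exact Or.inr ⟨p, rfl⟩
    · rcases x with x | x
      · rintro (⟨p, rfl⟩ | ⟨p, rfl⟩)
        · exact Or.inl ⟨Sum.inl p, rfl⟩
        · exact Or.inr ⟨Sum.inl p, rfl⟩
      · rintro (⟨p, rfl⟩ | ⟨p, rfl⟩)
        · exact Or.inl ⟨Sum.inr p, rfl⟩
        · exact Or.inr ⟨Sum.inr p, rfl⟩
  map := ⟨Sum.elim W.map W'.map, W.map.continuous.sumElim W'.map.continuous⟩
  map_bot := by
    rintro (p | p)
    · exact W.map_bot p
    · exact W'.map_bot p
  map_topm := by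
    rintro (p | p)
    · exact W.map_topm p
    · exact W'.map_topm p

theorem isDisjointUnion_sum (W : XCob M N) (W' : XCob M' N') :
    IsDisjointUnion (W.sum W') W W' :=
  ⟨Homeomorph.refl _, fun _ => rfl, fun _ => rfl, fun _ => rfl, fun _ => rfl, fun _ => rfl,
    fun _ => rfl⟩

/-- The cylinder over `M` with the map induced by the projection. -/
def cyl (M : XMfd X x₀) : XCob M M where
  carrier := M.carrier × I
  bot := ⟨fun m => (m, 0), by fun_prop⟩
  topm := ⟨fun m => (m, 1), by fun_prop⟩
  bot_injective _ _ h := congrArg Prod.fst h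
  topm_injective _ _ h := congrArg Prod.fst h
  disjoint := by
    rw [Set.disjoint_left]
    rintro _ ⟨p, rfl⟩ ⟨q, hq⟩
    exact one_ne_zero (congrArg Prod.snd hq)
  surface := by
    convert isSurfaceWithBoundary_prod M.charts using 1
    ext ⟨m, t⟩
    constructor
    · rintro (⟨p, hp⟩ | ⟨p, hp⟩)
      · exact Or.inl (congrArg Prod.snd hp).symm
      · exact Or.inr (congrArg Prod.snd hp).symm
    · rintro (h | h)
      · exact Or.inl ⟨m, Prod.ext rfl h.symm⟩
      · exact Or.inr ⟨m, Prod.ext rfl h.symm⟩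
  map := ⟨fun x => M.map x.1, by fun_prop⟩
  map_bot _ := rfl
  map_topm _ := rfl

theorem isCylinder_cyl (M : XMfd X x₀) : IsCylinder (cyl M) :=
  ⟨Homeomorph.refl _, fun _ => rfl, fun _ => rfl, fun m hm _ => M.map_base m hm⟩

/-- The cobordism `W` from `M` to `N` bent to a cobordism from `M ⊔ N'` to `∅`, where `N'` is
identified with `N` by a homeomorphism which need not respect the base points. -/
def bend (W : XCob M N) (ψ : N.carrier ≃ₜ N'.carrier) (hψ : ∀ p, N'.map (ψ p) = N.map p) :
    XCob (M.sum N') XMfd.empty where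
  carrier := W.carrier
  bot := ⟨Sum.elim W.bot fun n => W.topm (ψ.symm n), by
    exact W.bot.continuous.sumElim (W.topm.continuous.comp ψ.symm.continuous)⟩
  topm := ⟨Empty.elim, continuous_of_discreteTopology (α := Empty)⟩
  bot_injective := W.bot_injective.sumElim (W.topm_injective.comp ψ.symm.injective)
    fun m n => W.bot_ne_topm m (ψ.symm n)
  topm_injective x := Empty.elim x
  disjoint := by
    rw [Set.disjoint_right]
    rintro _ ⟨p, -⟩
    exact Empty.elim p
  surface := by
    convert W.surface using 1
    ext x
    constructor
    · rintro (⟨p | p, rfl⟩ | ⟨p, -⟩)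
      · exact Or.inl ⟨p, rfl⟩
      · exact Or.inr ⟨_, rfl⟩
      · exact Empty.elim p
    · rintro (⟨p, rfl⟩ | ⟨p, rfl⟩)
      · exact Or.inl ⟨Sum.inl p, rfl⟩
      · exact Or.inl ⟨Sum.inr (ψ p), congrArg W.topm (ψ.symm_apply_apply p)⟩
  map := W.map
  map_bot := by
    rintro (p | p)
    · exact W.map_bot p
    · refine (W.map_topm _).trans ?_
      rw [← hψ, ψ.apply_symm_apply]
      rfl
  map_topm p := Empty.elim p

/-- The cobordism with a collar attached to its bottom. -/
def collarBot (W : XCob M N) : XCob M N where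
  carrier := Collar (Set.range W.bot)
  compact := isCompact_iff_compactSpace.1 (Collar.isClosed W.isClosed_range_bot).isCompact
  bot := ⟨fun m => ⟨(W.bot m, 0), Or.inr ⟨m, rfl⟩⟩, by fun_prop⟩
  topm := ⟨fun n => ⟨(W.topm n, 1), Or.inl rfl⟩, by fun_prop⟩
  bot_injective _ _ h := W.bot_injective (congrArg (fun x => x.1.1) h)
  topm_injective _ _ h := W.topm_injective (congrArg (fun x => x.1.1) h)
  disjoint := by
    rw [Set.disjoint_left]
    rintro _ ⟨p, rfl⟩ ⟨q, hq⟩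
    exact one_ne_zero (congrArg (fun x => x.1.2) hq)
  surface := by
    convert IsSurfaceWithBoundary.collar W.isClosed_range_bot W.isClosed_range_topm W.disjoint
      W.surface using 1
    ext ⟨⟨w, s⟩, h⟩
    constructor
    · rintro (⟨p, hp⟩ | ⟨p, hp⟩)
      · exact Or.inl (congrArg (fun x => x.1.2) hp).symm
      · exact Or.inr ⟨(congrArg (fun x => x.1.2) hp).symm, p, congrArg (fun x => x.1.1) hp⟩
    · rintro (h1 | ⟨h1, p, hp⟩)
      · obtain rfl : s = 0 := h1
        obtain ⟨p, hp⟩ := h.resolve_left zero_ne_one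
        exact Or.inl ⟨p, Subtype.ext (Prod.ext hp rfl)⟩
      · exact Or.inr ⟨p, Subtype.ext (Prod.ext hp h1.symm)⟩
  map := ⟨fun x => W.map x.1.1, by fun_prop⟩
  map_bot := W.map_bot
  map_topm := W.map_topm

/-- The cobordism with a collar attached to its whole boundary. -/
def collar (W : XCob M N) : XCob M N where
  carrier := Collar (Set.range W.bot ∪ Set.range W.topm)
  compact := isCompact_iff_compactSpace.1
    (Collar.isClosed (W.isClosed_range_bot.union W.isClosed_range_topm)).isCompact
  bot := ⟨fun m => ⟨(W.bot m, 0), Or.inr (Or.inl ⟨m, rfl⟩)⟩, by fun_prop⟩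
  topm := ⟨fun n => ⟨(W.topm n, 0), Or.inr (Or.inr ⟨n, rfl⟩)⟩, by fun_prop⟩
  bot_injective _ _ h := W.bot_injective (congrArg (fun x => x.1.1) h)
  topm_injective _ _ h := W.topm_injective (congrArg (fun x => x.1.1) h)
  disjoint := by
    rw [Set.disjoint_left]
    rintro _ ⟨p, rfl⟩ ⟨q, hq⟩
    exact W.bot_ne_topm p q (congrArg (fun x => x.1.1) hq).symm
  surface := by
    -- The whole boundary is collared, so the uncollared part is empty and all of the new boundary
    -- lies at collar coordinate `0`.
    convert IsSurfaceWithBoundary.collar (W.isClosed_range_bot.union W.isClosed_range_topm)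
      isClosed_empty (Set.disjoint_empty _) (by rw [Set.union_empty]; exact W.surface) using 1
    ext ⟨⟨w, s⟩, h⟩
    constructor
    · rintro (⟨p, hp⟩ | ⟨p, hp⟩)
      · exact Or.inl (congrArg (fun x => x.1.2) hp).symm
      · exact Or.inl (congrArg (fun x => x.1.2) hp).symm
    · rintro (h1 | ⟨-, h1⟩)
      · obtain rfl : s = 0 := h1
        rcases h.resolve_left zero_ne_one with ⟨p, hp⟩ | ⟨p, hp⟩
        · exact Or.inl ⟨p, Subtype.ext (Prod.ext hp rfl)⟩
        · exact Or.inr ⟨p, Subtype.ext (Prod.ext hp rfl)⟩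
      · exact absurd h1 (Set.notMem_empty w)
  map := ⟨fun x => W.map x.1.1, by fun_prop⟩
  map_bot := W.map_bot
  map_topm := W.map_topm

/-- A collar at the bottom is a cylinder glued to the bottom. -/
theorem isGluing_collarBot (W : XCob M N) :
    IsGluing W.collarBot (cyl M) (XHomeo.refl M) W := by
  refine ⟨⟨fun x : M.carrier × I => ⟨(W.bot x.1, x.2), Or.inr ⟨x.1, rfl⟩⟩, by fun_prop⟩,
    ⟨fun w => ⟨(w, 1), Or.inl rfl⟩, by fun_prop⟩, ?_, ?_, ?_, ?_, fun _ => rfl, fun _ => rfl,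
    fun x => W.map_bot x.1, fun _ => rfl⟩
  · rintro ⟨m, s⟩ ⟨m', s'⟩ h
    exact Prod.ext (W.bot_injective (congrArg (fun x => x.1.1) h)) (congrArg (fun x => x.1.2) h)
  · exact fun w w' h => congrArg (fun x => x.1.1) h
  · refine Set.eq_univ_of_forall ?_
    rintro ⟨⟨w, s⟩, h | ⟨m, h⟩⟩
    · exact Or.inr ⟨w, Subtype.ext (Prod.ext rfl h.symm)⟩
    · exact Or.inl ⟨(m, s), Subtype.ext (Prod.ext h rfl)⟩
  · rintro ⟨m, s⟩ w
    constructor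
    · intro h
      have h1 : s = 1 := congrArg (fun x => x.1.2) h
      have h2 : W.bot m = w := congrArg (fun x => x.1.1) h
      exact ⟨m, Prod.ext rfl h1, h2.symm⟩
    · rintro ⟨n, h1, rfl⟩
      obtain ⟨rfl, rfl⟩ : m = n ∧ s = 1 := ⟨congrArg Prod.fst h1, congrArg Prod.snd h1⟩
      rfl

/-- Bending a cobordism amounts to gluing a bent cylinder to it. -/
theorem isGluing_bend_collar (W : XCob M N) (ψ : N.carrier ≃ₜ N'.carrier)
    (hψ : ∀ p, N'.map (ψ p) = N.map p) :
    IsGluing (W.collar.bend ψ hψ) (W.collarBot.sum (cyl N')) (XHomeo.refl (N.sum N'))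
      ((cyl N).bend ψ hψ) := by
  -- The collar over the top of `W` is cut at height `1/2`. The straight cylinder over `N'` fills
  -- the lower half by `s ↦ s/2`; the bent cylinder over `N` fills the upper half by `s ↦ 1 - s/2`,
  -- running from `W` down to `N'`.
  have hhalf : ∀ s : I, (affineI 0 ⟨1 / 2, by norm_num, by norm_num⟩ s : ℝ) = s / 2 := fun s => by
    rw [coe_affineI]; simp; ring
  have hhalf' : ∀ s : I, (affineI 1 ⟨1 / 2, by norm_num, by norm_num⟩ s : ℝ) = 1 - s / 2 :=
    fun s => by rw [coe_affineI]; simp; ring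
  set α := affineI 0 ⟨1 / 2, by norm_num, by norm_num⟩
  set α' := affineI 1 ⟨1 / 2, by norm_num, by norm_num⟩
  let j₀ : Collar (Set.range W.bot) ⊕ (N'.carrier × I) →
      Collar (Set.range W.bot ∪ Set.range W.topm) :=
    Sum.elim (fun x => ⟨x.1, x.2.imp_right Or.inl⟩)
      fun x => ⟨(W.topm (ψ.symm x.1), α x.2), Or.inr (Or.inr ⟨_, rfl⟩)⟩
  have hj₀ : Continuous j₀ := by
    refine Continuous.sumElim (by fun_prop) ?_
    have := ψ.symm.continuous
    fun_prop
  let j₁ : N.carrier × I → Collar (Set.range W.bot ∪ Set.range W.topm) :=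
    fun x => ⟨(W.topm x.1, α' x.2), Or.inr (Or.inr ⟨_, rfl⟩)⟩
  have hj₁ : Continuous j₁ := by fun_prop
  -- Since bottom and top of `W` are disjoint, the piece with collared bottom meets the collar over
  -- the top only at height `1`.
  have hne : ∀ (x : Collar (Set.range W.bot)) (n : N.carrier) (s : I), x.1 = (W.topm n, s) →
      s = 1 := by
    rintro ⟨⟨w, t⟩, h | ⟨m, h⟩⟩ n s hx
    · exact (congrArg Prod.snd hx).symm.trans h
    · exact absurd (h.trans (congrArg Prod.fst hx)) (W.bot_ne_topm m n)
  refine ⟨⟨j₀, hj₀⟩, ⟨j₁, hj₁⟩, ?_, ?_, ?_, ?_, ?_, fun p => Empty.elim p, ?_, ?_⟩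
  · have h01 : ∀ (x : Collar (Set.range W.bot)) (y : N'.carrier × I),
        j₀ (Sum.inl x) ≠ j₀ (Sum.inr y) := fun x y h => by
      have h1 := congrArg (Subtype.val (p := (· ∈ I))) (hne x _ _ (congrArg Subtype.val h))
      rw [hhalf] at h1
      have := y.2.2.2
      norm_num at h1
      linarith
    rintro (x | x) (y | y) h
    · have h1 : x.1 = y.1 := congrArg (fun x => x.1) h
      exact congrArg Sum.inl (Subtype.ext h1)
    · exact absurd h (h01 x y)
    · exact absurd h.symm (h01 y x)
    · have h1 : W.topm (ψ.symm x.1) = W.topm (ψ.symm y.1) := congrArg (fun x => x.1.1) h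
      have h2 : α x.2 = α y.2 := congrArg (fun x => x.1.2) h
      have h3 := congrArg (Subtype.val (p := (· ∈ I))) h2
      rw [hhalf, hhalf] at h3
      exact congrArg Sum.inr (Prod.ext (ψ.symm.injective (W.topm_injective h1))
        (Subtype.ext (by linarith)))
  · intro x y h
    have h1 : W.topm x.1 = W.topm y.1 := congrArg (fun x => x.1.1) h
    have h2 : α' x.2 = α' y.2 := congrArg (fun x => x.1.2) h
    have h3 := congrArg (Subtype.val (p := (· ∈ I))) h2
    rw [hhalf', hhalf'] at h3
    exact Prod.ext (W.topm_injective h1) (Subtype.ext (by linarith))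
  · refine Set.eq_univ_of_forall ?_
    rintro ⟨⟨w, s⟩, h | h | ⟨n, h⟩⟩
    · exact Or.inl ⟨Sum.inl ⟨(w, s), Or.inl h⟩, rfl⟩
    · exact Or.inl ⟨Sum.inl ⟨(w, s), Or.inr h⟩, rfl⟩
    · rcases le_total (s : ℝ) (1 / 2) with hs | hs
      · refine Or.inl ⟨Sum.inr (ψ n, ⟨2 * s, by linarith [s.2.1], by linarith⟩), ?_⟩
        refine Subtype.ext (Prod.ext ?_ (Subtype.ext ((hhalf _).trans ?_)))
        · exact (congrArg W.topm (ψ.symm_apply_apply n)).trans h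
        · show 2 * (s : ℝ) / 2 = s
          ring
      · refine Or.inr ⟨(n, ⟨2 - 2 * s, by linarith [s.2.2], by linarith⟩), ?_⟩
        refine Subtype.ext (Prod.ext h (Subtype.ext ((hhalf' _).trans ?_)))
        show 1 - (2 - 2 * (s : ℝ)) / 2 = s
        ring
  · rintro (x | ⟨n', s⟩) ⟨n, t⟩
    · constructor
      · intro h
        have h0 : x.1 = (W.topm n, α' t) := congrArg Subtype.val h
        have h1 := hne x _ _ h0
        have h2 := congrArg (Subtype.val (p := (· ∈ I))) h1
        rw [hhalf'] at h2
        have h3 : t = 0 := Subtype.ext (by norm_num at h2; simpa using h2)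
        refine ⟨Sum.inl n, congrArg Sum.inl (Subtype.ext (h0.trans (Prod.ext rfl h1))),
          Prod.ext rfl h3⟩
      · rintro ⟨p | p, h1, h2⟩
        · obtain ⟨rfl, rfl⟩ : n = p ∧ t = 0 := ⟨congrArg Prod.fst h2, congrArg Prod.snd h2⟩
          obtain rfl := Sum.inl_injective h1
          refine Subtype.ext (Prod.ext rfl (Subtype.ext (((hhalf' 0).trans
            (show 1 - ((0 : I) : ℝ) / 2 = 1 by norm_num)).symm)))
        · cases h1
    · constructor
      · intro h
        have h1 : W.topm (ψ.symm n') = W.topm n := congrArg (fun x => x.1.1) h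
        have h2 : α s = α' t := congrArg (fun x => x.1.2) h
        have h3 := congrArg (Subtype.val (p := (· ∈ I))) h2
        rw [hhalf, hhalf'] at h3
        have hs := s.2.2
        have ht := t.2.2
        have h4 : s = 1 := Subtype.ext (show (s : ℝ) = 1 by linarith)
        have h5 : t = 1 := Subtype.ext (show (t : ℝ) = 1 by linarith)
        exact ⟨Sum.inr n', congrArg Sum.inr (Prod.ext rfl h4),
          Prod.ext (W.topm_injective h1).symm h5⟩
      · rintro ⟨p | p, h1, h2⟩
        · cases h1
        · have h3 := Sum.inr_injective h1
          obtain ⟨rfl, rfl⟩ : n' = p ∧ s = 1 := ⟨congrArg Prod.fst h3, congrArg Prod.snd h3⟩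
          obtain ⟨rfl, rfl⟩ : n = ψ.symm n' ∧ t = 1 :=
            ⟨congrArg Prod.fst h2, congrArg Prod.snd h2⟩
          refine Subtype.ext (Prod.ext rfl (Subtype.ext (((hhalf 1).trans ?_).trans
            (hhalf' 1).symm)))
          norm_num
  · rintro (p | p)
    · rfl
    · exact Subtype.ext (Prod.ext rfl (Subtype.ext (((hhalf 0).trans
        (show ((0 : I) : ℝ) / 2 = 0 by norm_num)).symm)))
  · rintro (x | x)
    · rfl
    · refine (W.map_topm _).trans ?_
      rw [← hψ, ψ.apply_symm_apply]
      rfl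
  · exact fun x => W.map_topm x.1

end XCob

end


/-! ### The zigzag of bent cylinders -/

section

variable {X : Type*} [TopologicalSpace X] {x₀ : X}

/-- The cylinder over `M` as a cobordism from `∅ ⊔ M` to `M ⊔ ∅`. -/
def XCob.shiftCyl (M : XMfd X x₀) : XCob (XMfd.empty.sum M) (M.sum XMfd.empty) :=
  (XCob.cyl M).reindex ((XHomeo.comm XMfd.empty M).trans (XHomeo.sumEmpty M)) (XHomeo.sumEmpty M)

/-- A cylinder is obtained by gluing two bent cylinders and two straight ones in a zigzag. -/
theorem XCob.isGluing_zigzag {M M' : XMfd X x₀} (φ : M.carrier ≃ₜ M'.carrier)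
    (hφ : ∀ p, M'.map (φ p) = M.map p) (hφ' : ∀ p, M.map (φ.symm p) = M'.map p) :
    IsGluing (shiftCyl M) (((cyl M).bend φ hφ).reverse.sum (cyl M)) (XHomeo.assoc M M' M)
      ((cyl M).sum ((cyl M').bend φ.symm hφ')) := by
  -- The cylinder `M × [0,1]` is cut into quarters. From below they are the straight cylinder of the
  -- first layer, the bent cylinder over `M'` run backwards, the bent cylinder over `M` run
  -- backwards, and the straight cylinder of the second layer.
  let q₁ : I := ⟨1 / 4, by norm_num, by norm_num⟩
  let q₂ : I := ⟨1 / 2, by norm_num, by norm_num⟩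
  let q₃ : I := ⟨3 / 4, by norm_num, by norm_num⟩
  have c0 : ((0 : I) : ℝ) = 0 := rfl
  have c1 : ((1 : I) : ℝ) = 1 := rfl
  have h₁ : ∀ s : I, (affineI 0 q₁ s : ℝ) = s / 4 := fun s => by
    rw [coe_affineI, c0]; simp only [q₁]; ring
  have h₂ : ∀ s : I, (affineI q₂ q₁ s : ℝ) = 1 / 2 - s / 4 := fun s => by
    rw [coe_affineI]; simp only [q₁, q₂]; ring
  have h₃ : ∀ s : I, (affineI q₃ q₂ s : ℝ) = 3 / 4 - s / 4 := fun s => by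
    rw [coe_affineI]; simp only [q₂, q₃]; ring
  have h₄ : ∀ s : I, (affineI q₃ 1 s : ℝ) = 3 / 4 + s / 4 := fun s => by
    rw [coe_affineI, c1]; simp only [q₃]; ring
  -- The quarters match at `3/4`, `1/2` and `1/4`, and the outer ends are `0` and `1`.
  have e₁ : affineI q₃ q₂ 0 = affineI q₃ 1 0 := Subtype.ext (by rw [h₃, h₄, c0]; norm_num)
  have e₂ : affineI q₃ q₂ 1 = affineI q₂ q₁ 0 := Subtype.ext (by rw [h₂, h₃, c0, c1]; norm_num)
  have e₃ : affineI 0 q₁ 1 = affineI q₂ q₁ 1 := Subtype.ext (by rw [h₁, h₂, c1]; norm_num)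
  have e₄ : 0 = affineI 0 q₁ 0 := Subtype.ext (by rw [h₁, c0]; norm_num)
  have e₅ : 1 = affineI q₃ 1 1 := Subtype.ext (by rw [h₄, c1]; norm_num)
  let j₀ : (M.carrier × I) ⊕ (M.carrier × I) → M.carrier × I :=
    Sum.elim (fun x => (x.1, affineI q₃ q₂ x.2)) fun x => (x.1, affineI 0 q₁ x.2)
  have hj₀ : Continuous j₀ := Continuous.sumElim (by fun_prop) (by fun_prop)
  let j₁ : (M.carrier × I) ⊕ (M'.carrier × I) → M.carrier × I :=
    Sum.elim (fun x => (x.1, affineI q₃ 1 x.2)) fun x => (φ.symm x.1, affineI q₂ q₁ x.2)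
  have hj₁ : Continuous j₁ := by
    have := φ.symm.continuous
    exact Continuous.sumElim (by fun_prop) (by fun_prop)
  have hsnd : ∀ {m m' : M.carrier} {s t : I}, (m, s) = (m', t) → (s : ℝ) = t := fun h =>
    congrArg (fun x => (x.2 : ℝ)) h
  refine ⟨⟨j₀, hj₀⟩, ⟨j₁, hj₁⟩, ?_, ?_, ?_, ?_, ?_, ?_, ?_, ?_⟩
  · rintro (⟨m, s⟩ | ⟨m, s⟩) (⟨m', t⟩ | ⟨m', t⟩) h
    all_goals
      have h0 : m = m' := congrArg Prod.fst h
      have h5 := hsnd h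
      rw [h0]
      simp only [h₁, h₃] at h5
      have hs := s.2.1
      have hs' := s.2.2
      have ht := t.2.1
      have ht' := t.2.2
    · rw [show s = t from Subtype.ext (by linarith)]
    · linarith
    · linarith
    · rw [show s = t from Subtype.ext (by linarith)]
  · rintro (⟨m, s⟩ | ⟨m, s⟩) (⟨m', t⟩ | ⟨m', t⟩) h
    all_goals
      have h0 := congrArg Prod.fst h
      have h5 := hsnd h
      simp only [h₂, h₄] at h5
      have hs := s.2.1
      have hs' := s.2.2
      have ht := t.2.1
      have ht' := t.2.2
    · exact congrArg Sum.inl (Prod.ext h0 (Subtype.ext (by linarith)))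
    · linarith
    · linarith
    · exact congrArg Sum.inr (Prod.ext (φ.symm.injective h0) (Subtype.ext (by linarith)))
  · refine Set.eq_univ_of_forall ?_
    rintro ⟨m, s⟩
    have hs := s.2.1
    have hs' := s.2.2
    rcases le_total (s : ℝ) (1 / 2) with h5 | h5
    · rcases le_total (s : ℝ) (1 / 4) with h6 | h6
      · refine Or.inl ⟨Sum.inr (m, ⟨4 * s, by linarith, by linarith⟩), ?_⟩
        refine Prod.ext rfl (Subtype.ext ((h₁ _).trans ?_))
        show 4 * (s : ℝ) / 4 = s
        ring
      · refine Or.inr ⟨Sum.inr (φ m, ⟨2 - 4 * s, by linarith, by linarith⟩), ?_⟩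
        refine Prod.ext (φ.symm_apply_apply m) (Subtype.ext ((h₂ _).trans ?_))
        show 1 / 2 - (2 - 4 * (s : ℝ)) / 4 = s
        ring
    · rcases le_total (s : ℝ) (3 / 4) with h6 | h6
      · refine Or.inl ⟨Sum.inl (m, ⟨3 - 4 * s, by linarith, by linarith⟩), ?_⟩
        refine Prod.ext rfl (Subtype.ext ((h₃ _).trans ?_))
        show 3 / 4 - (3 - 4 * (s : ℝ)) / 4 = s
        ring
      · refine Or.inr ⟨Sum.inl (m, ⟨4 * s - 3, by linarith, by linarith⟩), ?_⟩
        refine Prod.ext rfl (Subtype.ext ((h₄ _).trans ?_))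
        show 3 / 4 + (4 * (s : ℝ) - 3) / 4 = s
        ring
  -- The first layer consists of the third and the first quarter, the second layer of the fourth and
  -- the second. Three of the four pairs are adjacent and meet in one copy of `M`; the first and the
  -- fourth quarter do not meet.
  · rintro (⟨m, s⟩ | ⟨m, s⟩) (⟨m', t⟩ | ⟨m', t⟩)
    all_goals
      have hs := s.2.1
      have hs' := s.2.2
      have ht := t.2.1
      have ht' := t.2.2
      constructor
    · intro h
      have h0 : m = m' := congrArg Prod.fst h
      have h5 := hsnd h
      simp only [h₃, h₄] at h5
      obtain rfl : s = 0 := Subtype.ext (show (s : ℝ) = 0 by linarith)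
      obtain rfl : t = 0 := Subtype.ext (show (t : ℝ) = 0 by linarith)
      subst h0
      exact ⟨Sum.inl (Sum.inl m), rfl, rfl⟩
    · rintro ⟨(p | p) | p, h5, h6⟩
      · obtain ⟨rfl, rfl⟩ := Prod.mk.inj (Sum.inl_injective h5)
        obtain ⟨rfl, rfl⟩ := Prod.mk.inj (Sum.inl_injective h6)
        exact Prod.ext rfl e₁
      · cases h6
      · cases h6
    · intro h
      have h0 : m = φ.symm m' := congrArg Prod.fst h
      have h5 := hsnd h
      simp only [h₂, h₃] at h5
      obtain rfl : s = 1 := Subtype.ext (show (s : ℝ) = 1 by linarith)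
      obtain rfl : t = 0 := Subtype.ext (show (t : ℝ) = 0 by linarith)
      subst h0
      exact ⟨Sum.inl (Sum.inr m'), rfl, rfl⟩
    · rintro ⟨(p | p) | p, h5, h6⟩
      · cases h6
      · obtain ⟨rfl, rfl⟩ := Prod.mk.inj (Sum.inl_injective h5)
        obtain ⟨rfl, rfl⟩ := Prod.mk.inj (Sum.inr_injective h6)
        exact Prod.ext rfl e₂
      · cases h5
    · intro h
      have h5 := hsnd h
      simp only [h₁, h₄] at h5
      linarith
    · rintro ⟨(p | p) | p, h5, h6⟩
      · cases h5
      · cases h5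
      · cases h6
    · intro h
      have h0 : m = φ.symm m' := congrArg Prod.fst h
      have h5 := hsnd h
      simp only [h₁, h₂] at h5
      obtain rfl : s = 1 := Subtype.ext (show (s : ℝ) = 1 by linarith)
      obtain rfl : t = 1 := Subtype.ext (show (t : ℝ) = 1 by linarith)
      subst h0
      refine ⟨Sum.inr (φ.symm m'), rfl, congrArg Sum.inr (Prod.ext ?_ rfl)⟩
      exact (φ.apply_symm_apply m').symm
    · rintro ⟨(p | p) | p, h5, h6⟩
      · cases h5
      · cases h5
      · obtain ⟨rfl, rfl⟩ := Prod.mk.inj (Sum.inr_injective h5)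
        obtain ⟨rfl, rfl⟩ := Prod.mk.inj (Sum.inr_injective h6)
        exact Prod.ext (φ.symm_apply_apply m).symm e₃
  · rintro (p | p)
    · exact Empty.elim p
    · exact Prod.ext rfl e₄
  · rintro (p | p)
    · exact Prod.ext rfl e₅
    · exact Empty.elim p
  · rintro (x | x)
    · rfl
    · rfl
  · rintro (x | x)
    · rfl
    · exact hφ' x.1

end


/-! ### The pairing of a theory -/

namespace HQFT

variable {R : Type*} [CommRing R] {X : Type*} [TopologicalSpace X] {x₀ : X} (A : HQFT R X x₀)
  {M N M' N' : XMfd X x₀}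

/-- The identity composed with itself is the identity, so its push-forward is idempotent; an
injective idempotent is the identity. -/
theorem push_refl (a : A.obj M) : A.push (XHomeo.refl M) a = a :=
  (A.push (XHomeo.refl M)).injective (A.push_trans (XHomeo.refl M) (XHomeo.refl M) a).symm

/-- The collar is a glued cylinder, which acts as the identity. -/
theorem τ_collarBot (W : XCob M N) : A.τ W.collarBot = A.τ W := by
  ext a
  rw [A.τ_gluing _ _ _ _ W.isGluing_collarBot, push_refl,
    A.τ_cylinder _ (XCob.isCylinder_cyl M), LinearMap.id_apply]

theorem τ_sum_tmul (W : XCob M N) (W' : XCob M' N') (a : A.obj M) (a' : A.obj M') :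
    A.τ (W.sum W') ((A.tensor M M').symm (a ⊗ₜ a')) =
      (A.tensor N N').symm (A.τ W a ⊗ₜ A.τ W' a') := by
  rw [LinearEquiv.eq_symm_apply, A.τ_sum _ _ _ (XCob.isDisjointUnion_sum W W'),
    LinearEquiv.apply_symm_apply, TensorProduct.map_tmul]

/-- The bilinear form defined by a cobordism from `M ⊔ N` to `∅`. -/
def form (W : XCob (M.sum N) XMfd.empty) : A.obj M →ₗ[R] A.obj N →ₗ[R] R :=
  TensorProduct.curry (A.unit.toLinearMap ∘ₗ A.τ W ∘ₗ (A.tensor M N).symm.toLinearMap)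

theorem form_apply (W : XCob (M.sum N) XMfd.empty) (a : A.obj M) (c : A.obj N) :
    A.form W a c = A.unit (A.τ W ((A.tensor M N).symm (a ⊗ₜ c))) := rfl

/-- Naturality under the swap of the two bottom manifolds, combined with the compatibility of
`tensor` with that swap. The form thus depends only on the surface with its labelled boundary, not
on the order of the two parts. -/
theorem form_comm (W : XCob (M.sum N) XMfd.empty) (W' : XCob (N.sum M) XMfd.empty)
    (F : W.carrier ≃ₜ W'.carrier)
    (hF : ∀ p, F (W.bot p) = W'.bot ((XHomeo.comm M N).homeo p))
    (hmap : ∀ w, W'.map (F w) = W.map w) (a : A.obj M) (c : A.obj N) :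
    A.form W' c a = A.form W a c := by
  have h := A.τ_natural W W' (XHomeo.comm M N) (XHomeo.refl _) F ⟨hF, fun p => Empty.elim p, hmap⟩
    ((A.tensor M N).symm (a ⊗ₜ c))
  have h1 : A.push (XHomeo.comm M N) ((A.tensor M N).symm (a ⊗ₜ c)) =
      (A.tensor N M).symm (c ⊗ₜ a) := by
    rw [LinearEquiv.eq_symm_apply, A.tensor_comm, LinearEquiv.apply_symm_apply,
      TensorProduct.comm_tmul]
  rw [h1, push_refl] at h
  rw [form_apply, form_apply, h]

/-- The bilinear form defined by the cylinder over `M`, whose upper end is identified with `M'` by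
a homeomorphism over the target which need not respect the base points. -/
def pairing (φ : M.carrier ≃ₜ M'.carrier) (hφ : ∀ p, M'.map (φ p) = M.map p) :
    A.obj M →ₗ[R] A.obj M' →ₗ[R] R :=
  A.form ((XCob.cyl M).bend φ hφ)

/-- Reflecting the interval exchanges the two ends of the bent cylinder. -/
theorem pairing_symm (φ : M.carrier ≃ₜ M'.carrier) (hφ : ∀ p, M'.map (φ p) = M.map p)
    (hφ' : ∀ p, M.map (φ.symm p) = M'.map p) (a : A.obj M) (c : A.obj M') :
    A.pairing φ.symm hφ' c a = A.pairing φ hφ a c := by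
  let σ' : I ≃ₜ I := ⟨⟨σ, σ, unitInterval.symm_symm, unitInterval.symm_symm⟩,
    unitInterval.continuous_symm, unitInterval.continuous_symm⟩
  refine A.form_comm _ _ (φ.prodCongr σ') ?_ (fun w : M.carrier × I => hφ w.1) a c
  rintro (p | p)
  · exact Prod.ext rfl unitInterval.symm_zero
  · exact Prod.ext (φ.apply_symm_apply p) unitInterval.symm_one

/-- Applying `τ W` to the first argument glues `W` to one leg of the bent cylinder, which leaves `W`
with its whole boundary moved to the bottom. Collaring the bottom as well costs nothing and makes
the right side symmetric in the two ends of `W`. -/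
theorem pairing_τ (W : XCob M N) (ψ : N.carrier ≃ₜ N'.carrier) (hψ : ∀ p, N'.map (ψ p) = N.map p)
    (a : A.obj M) (c : A.obj N') :
    A.pairing ψ hψ (A.τ W a) c = A.form (W.collar.bend ψ hψ) a c := by
  rw [form_apply, A.τ_gluing _ _ _ _ (W.isGluing_bend_collar ψ hψ), push_refl, τ_sum_tmul,
    τ_collarBot, A.τ_cylinder _ (XCob.isCylinder_cyl N')]
  rfl

/-- The maps defined by a cobordism and by the reversed cobordism are adjoint. -/
theorem pairing_adjoint (W : XCob M N) (V : XCob N' M')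
    (φ : M.carrier ≃ₜ M'.carrier) (hφ : ∀ p, M'.map (φ p) = M.map p)
    (ψ : N.carrier ≃ₜ N'.carrier) (hψ : ∀ p, N'.map (ψ p) = N.map p)
    (Φ : W.carrier ≃ₜ V.carrier) (hbot : ∀ m, Φ (W.bot m) = V.topm (φ m))
    (htop : ∀ n, Φ (W.topm n) = V.bot (ψ n)) (hmap : ∀ w, V.map (Φ w) = W.map w)
    (a : A.obj M) (c : A.obj N') :
    A.pairing ψ hψ (A.τ W a) c = A.pairing φ hφ a (A.τ V c) := by
  have hφ' : ∀ p, M.map (φ.symm p) = M'.map p := fun p => by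
    rw [← hφ, φ.apply_symm_apply]
  -- Both sides are now forms of bent collared surfaces. The homeomorphism `Φ` extends over the
  -- collars and swaps the two bottom parts, so `form_comm` identifies the values.
  rw [← A.pairing_symm φ hφ hφ', pairing_τ, pairing_τ]
  have hset : ∀ w, w ∈ Set.range W.bot ∪ Set.range W.topm ↔
      Φ w ∈ Set.range V.bot ∪ Set.range V.topm := by
    intro w
    constructor
    · rintro (⟨p, rfl⟩ | ⟨p, rfl⟩)
      · exact Or.inr ⟨φ p, (hbot p).symm⟩
      · exact Or.inl ⟨ψ p, (htop p).symm⟩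
    · rintro (⟨p, hp⟩ | ⟨p, hp⟩)
      · refine Or.inr ⟨ψ.symm p, Φ.injective ?_⟩
        rw [htop, ψ.apply_symm_apply, hp]
      · refine Or.inl ⟨φ.symm p, Φ.injective ?_⟩
        rw [hbot, φ.apply_symm_apply, hp]
  let F : Collar (Set.range W.bot ∪ Set.range W.topm) ≃ₜ
      Collar (Set.range V.bot ∪ Set.range V.topm) :=
    (Φ.prodCongr (Homeomorph.refl I)).subtype fun x => or_congr Iff.rfl (hset x.1)
  refine (A.form_comm _ _ F ?_ (fun w : Collar (Set.range W.bot ∪ Set.range W.topm) => hmap w.1.1) a c).symm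
  rintro (p | p)
  · refine Subtype.ext (Prod.ext ((hbot p).trans ?_) rfl)
    exact rfl
  · refine Subtype.ext (Prod.ext ((htop _).trans ?_) rfl)
    exact congrArg V.bot (ψ.apply_symm_apply p)

/-- Up to the isomorphisms `∅ ⊔ M ≅ M ≅ M ⊔ ∅` this is the cylinder, hence the identity. -/
theorem τ_shiftCyl_injective (M : XMfd X x₀) : Function.Injective (A.τ (XCob.shiftCyl M)) := by
  intro x y hxy
  have h := A.τ_natural (XCob.shiftCyl M) (XCob.cyl M)
    ((XHomeo.comm XMfd.empty M).trans (XHomeo.sumEmpty M)) (XHomeo.sumEmpty M) (Homeomorph.refl _)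
    ⟨fun _ => rfl, fun _ => rfl, fun _ => rfl⟩
  rw [A.τ_cylinder _ (XCob.isCylinder_cyl M)] at h
  apply (A.push ((XHomeo.comm XMfd.empty M).trans (XHomeo.sumEmpty M))).injective
  rw [← LinearMap.id_apply (R := R) (A.push _ x), ← LinearMap.id_apply (R := R) (A.push _ y), h, h,
    hxy]

/-- The first layer of the zigzag creates an element of `A(M ⊔ M')` next to `a`; the second layer
pairs its `M'` factor with `a`. If all these pairings vanish, the zigzag kills `1 ⊗ a`. Since it
acts injectively, `a = 0`. -/
theorem eq_zero_of_pairing_symm (φ : M.carrier ≃ₜ M'.carrier) (hφ : ∀ p, M'.map (φ p) = M.map p)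
    (hφ' : ∀ p, M.map (φ.symm p) = M'.map p) (a : A.obj M)
    (ha : ∀ c, A.pairing φ.symm hφ' c a = 0) : a = 0 := by
  have hτ : ∀ c, A.τ ((XCob.cyl M').bend φ.symm hφ') ((A.tensor M' M).symm (c ⊗ₜ a)) = 0 :=
    fun c => A.unit.injective ((ha c).trans (map_zero _).symm)
  let u : A.obj XMfd.empty := A.unit.symm 1
  have key : A.τ (XCob.shiftCyl M) ((A.tensor XMfd.empty M).symm (u ⊗ₜ a)) = 0 := by
    rw [A.τ_gluing _ _ _ _ (XCob.isGluing_zigzag φ hφ hφ'), τ_sum_tmul,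
      A.τ_cylinder _ (XCob.isCylinder_cyl M), LinearMap.id_apply]
    -- All that matters about the created element is that it is a sum of pure tensors.
    generalize A.τ ((XCob.cyl M).bend φ hφ).reverse u = C
    obtain ⟨C, rfl⟩ := (A.tensor M M').symm.surjective C
    induction C with
    | zero => simp
    | add C C' h h' => simp only [map_add, TensorProduct.add_tmul, h, h', add_zero]
    | tmul b c =>
      have h := A.tensor_assoc M M' M
        ((A.tensor (M.sum M') M).symm ((A.tensor M M').symm (b ⊗ₜ c) ⊗ₜ a))
      rw [LinearEquiv.apply_symm_apply, TensorProduct.congr_tmul, LinearEquiv.apply_symm_apply,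
        LinearEquiv.refl_apply, TensorProduct.assoc_tmul] at h
      -- Coherence with associativity rebrackets `(b ⊗ c) ⊗ a` as `b ⊗ (c ⊗ a)`, on which the second
      -- layer acts factor by factor.
      have h1 : A.push (XHomeo.assoc M M' M)
          ((A.tensor (M.sum M') M).symm ((A.tensor M M').symm (b ⊗ₜ c) ⊗ₜ a)) =
          (A.tensor M (M'.sum M)).symm (b ⊗ₜ (A.tensor M' M).symm (c ⊗ₜ a)) := by
        rw [LinearEquiv.eq_symm_apply]
        apply (TensorProduct.congr (LinearEquiv.refl R (A.obj M)) (A.tensor M' M)).injective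
        rw [← h, TensorProduct.congr_tmul, LinearEquiv.apply_symm_apply, LinearEquiv.refl_apply]
      rw [h1, τ_sum_tmul, hτ, TensorProduct.tmul_zero, map_zero]
  have h0 : u ⊗ₜ[R] a = 0 := by
    apply (A.tensor XMfd.empty M).symm.injective
    apply A.τ_shiftCyl_injective M
    rw [key, map_zero, map_zero]
  have h1 := congrArg (fun x => TensorProduct.lid R (A.obj M)
    (TensorProduct.congr A.unit (LinearEquiv.refl R (A.obj M)) x)) h0
  simpa [u] using h1

theorem pairing_nondegenerate (φ : M.carrier ≃ₜ M'.carrier)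
    (hφ : ∀ p, M'.map (φ p) = M.map p) : (A.pairing φ hφ).Nondegenerate := by
  have hφ' : ∀ p, M.map (φ.symm p) = M'.map p := fun p => by
    rw [← hφ, φ.apply_symm_apply]
  refine ⟨fun a ha => ?_, fun c hc => ?_⟩
  · exact A.eq_zero_of_pairing_symm φ hφ hφ' a fun c => (A.pairing_symm φ hφ hφ' a c).trans (ha c)
  · exact A.eq_zero_of_pairing_symm φ.symm hφ' hφ c hc

end HQFT


/-! ### Homology of dual sequences -/

theorem isPerfPair_of_nondegenerate {k V V' : Type*} [Field k] [AddCommGroup V] [Module k V]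
    [AddCommGroup V'] [Module k V'] [FiniteDimensional k V] {B : V →ₗ[k] V' →ₗ[k] k}
    (h : B.Nondegenerate) : B.IsPerfPair :=
  LinearMap.IsPerfPair.of_injective
    ((injective_iff_map_eq_zero _).2 fun a ha => h.1 a fun b => by rw [ha]; rfl)
    ((injective_iff_map_eq_zero _).2 fun a ha => h.2 a fun b => by rw [← B.flip_apply, ha]; rfl)

/-- Since `p` is not assumed to lie in `q`, the quotient is really by `p ⊓ q`. Homology can
therefore be counted without knowing that consecutive differentials compose to zero. -/
theorem finrank_quotient_submoduleOf {k V : Type*} [Field k] [AddCommGroup V] [Module k V]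
    [FiniteDimensional k V] (p q : Submodule k V) :
    Module.finrank k (q ⧸ p.submoduleOf q) + Module.finrank k (p ⊓ q : Submodule k V) =
      Module.finrank k q := by
  rw [← (p.submoduleOf q).finrank_quotient_add_finrank, ← Submodule.finrank_map_subtype_eq,
    Submodule.submoduleOf, Submodule.map_comap_subtype, inf_comm]

/-- Two sequences which are dual to each other have homology of the same dimension. -/
theorem nonempty_homology_equiv_of_pairing {k U V W U' V' W' : Type*} [Field k]
    [AddCommGroup U] [Module k U] [AddCommGroup V] [Module k V] [AddCommGroup W] [Module k W]
    [AddCommGroup U'] [Module k U'] [AddCommGroup V'] [Module k V'] [AddCommGroup W'] [Module k W']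
    [FiniteDimensional k U] [FiniteDimensional k V] [FiniteDimensional k W]
    {BU : U →ₗ[k] U' →ₗ[k] k} {BV : V →ₗ[k] V' →ₗ[k] k} {BW : W →ₗ[k] W' →ₗ[k] k}
    (hU : BU.Nondegenerate) (hV : BV.Nondegenerate) (hW : BW.Nondegenerate)
    (d₀ : U →ₗ[k] V) (d₁ : V →ₗ[k] W) (e₀ : W' →ₗ[k] V') (e₁ : V' →ₗ[k] U')
    (h₀ : ∀ u v', BV (d₀ u) v' = BU u (e₁ v')) (h₁ : ∀ v w', BW (d₁ v) w' = BV v (e₀ w')) :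
    Nonempty ((LinearMap.ker d₁ ⧸ (LinearMap.range d₀).submoduleOf (LinearMap.ker d₁)) ≃ₗ[k]
      (LinearMap.ker e₁ ⧸ (LinearMap.range e₀).submoduleOf (LinearMap.ker e₁))) := by
  have := isPerfPair_of_nondegenerate hU
  have := isPerfPair_of_nondegenerate hV
  have := isPerfPair_of_nondegenerate hW
  -- The primed spaces become the duals of the unprimed ones, and `e₁`, `e₀` become the transposes
  -- of `d₀`, `d₁`.
  let TU := BU.flip.toPerfPair
  let TV := BV.flip.toPerfPair
  let TW := BW.flip.toPerfPair
  have : FiniteDimensional k V' := Module.Finite.equiv TV.symm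
  have k0 : ∀ v', TU (e₁ v') = d₀.dualMap (TV v') := fun v' =>
    LinearMap.ext fun u => (h₀ u v').symm
  have k1 : ∀ w', TV (e₀ w') = d₁.dualMap (TW w') := fun w' =>
    LinearMap.ext fun v => (h₁ v w').symm
  have hker : (LinearMap.ker e₁).map TV.toLinearMap = (LinearMap.range d₀).dualAnnihilator := by
    rw [← LinearMap.ker_dualMap_eq_dualAnnihilator_range]
    ext f
    obtain ⟨v', rfl⟩ := TV.surjective f
    rw [LinearMap.mem_ker, ← k0, LinearEquiv.map_eq_zero_iff]
    refine ⟨?_, fun hv => ⟨v', hv, rfl⟩⟩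
    rintro ⟨w', hw, hwv⟩
    exact TV.injective hwv ▸ hw
  have hrange : (LinearMap.range e₀).map TV.toLinearMap =
      (LinearMap.ker d₁).dualAnnihilator := by
    rw [← LinearMap.range_dualMap_eq_dualAnnihilator_ker]
    ext f
    constructor
    · rintro ⟨_, ⟨w', rfl⟩, rfl⟩
      exact ⟨TW w', (k1 w').symm⟩
    · rintro ⟨g, rfl⟩
      obtain ⟨w', rfl⟩ := TW.surjective g
      exact ⟨_, ⟨w', rfl⟩, k1 w'⟩
  apply FiniteDimensional.nonempty_linearEquiv_of_finrank_eq
  -- With `K = ker d₁` and `B = im d₀`, the dual homology has dimension `dim ann B - dim ann (K + B)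
  -- = dim (K + B) - dim B = dim K - dim (K ∩ B)`.
  have a1 := finrank_quotient_submoduleOf (LinearMap.range d₀) (LinearMap.ker d₁)
  have a2 := finrank_quotient_submoduleOf (LinearMap.range e₀) (LinearMap.ker e₁)
  have a3 := TV.finrank_map_eq (LinearMap.ker e₁)
  have a4 := TV.finrank_map_eq (LinearMap.range e₀ ⊓ LinearMap.ker e₁)
  rw [hker] at a3
  rw [Submodule.map_inf _ TV.injective, hker, hrange, ← Submodule.dualAnnihilator_sup_eq] at a4
  have a5 := Subspace.finrank_add_finrank_dualAnnihilator_eq (LinearMap.range d₀)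
  have a6 := Subspace.finrank_add_finrank_dualAnnihilator_eq
    (LinearMap.ker d₁ ⊔ LinearMap.range d₀)
  have a7 := Submodule.finrank_sup_add_finrank_inf_eq (LinearMap.ker d₁) (LinearMap.range d₀)
  rw [inf_comm] at a7
  omega

/-! ### Orthogonal sums of pairings -/

section

variable {R α α' β β' : Type*} [CommRing R] [Fintype α] [Fintype β] [Fintype β']
  {P : α → Type*} [∀ a, AddCommGroup (P a)] [∀ a, Module R (P a)]
  {P' : α' → Type*} [∀ a, AddCommGroup (P' a)] [∀ a, Module R (P' a)]
  {Q : β → Type*} [∀ a, AddCommGroup (Q a)] [∀ a, Module R (Q a)]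
  {Q' : β' → Type*} [∀ a, AddCommGroup (Q' a)] [∀ a, Module R (Q' a)]

/-- The orthogonal sum of a family of pairings. -/
def familyPairing (e : α ≃ α') (B : ∀ a, P a →ₗ[R] P' (e a) →ₗ[R] R) :
    (∀ a, P a) →ₗ[R] (∀ a, P' a) →ₗ[R] R :=
  ∑ a, (B a).compl₁₂ (LinearMap.proj a) (LinearMap.proj (e a))

theorem familyPairing_apply (e : α ≃ α') (B : ∀ a, P a →ₗ[R] P' (e a) →ₗ[R] R) (x : ∀ a, P a)
    (y : ∀ a, P' a) : familyPairing e B x y = ∑ a, B a (x a) (y (e a)) := by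
  simp [familyPairing, LinearMap.sum_apply]

/-- Testing against a family supported at one index isolates a single summand. -/
theorem familyPairing_nondegenerate (e : α ≃ α') {B : ∀ a, P a →ₗ[R] P' (e a) →ₗ[R] R}
    (hB : ∀ a, (B a).Nondegenerate) : (familyPairing e B).Nondegenerate := by
  classical
  constructor
  · intro x hx
    refine funext fun a => (hB a).1 _ fun c => ?_
    have h := hx (Pi.single (e a) c)
    rwa [familyPairing_apply, Finset.sum_eq_single a, Pi.single_eq_same] at h
    · intro a' _ ha
      rw [Pi.single_eq_of_ne (e.injective.ne ha), map_zero]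
    · exact fun h => absurd (Finset.mem_univ _) h
  · intro y hy
    refine funext fun a' => ?_
    obtain ⟨a, rfl⟩ := e.surjective a'
    refine (hB a).2 _ fun c => ?_
    have h := hy (Pi.single a c)
    rwa [familyPairing_apply, Finset.sum_eq_single a, Pi.single_eq_same] at h
    · intro a' _ ha
      rw [Pi.single_eq_of_ne ha, map_zero, LinearMap.zero_apply]
    · exact fun h => absurd (Finset.mem_univ _) h

/-- Matrices with adjoint entries are adjoint. -/
theorem familyPairing_adjoint (e : α ≃ α') (e' : β ≃ β') (B : ∀ a, P a →ₗ[R] P' (e a) →ₗ[R] R)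
    (C : ∀ b, Q b →ₗ[R] Q' (e' b) →ₗ[R] R) (f : ∀ a b, P a →ₗ[R] Q b)
    (g : ∀ b a, Q' b →ₗ[R] P' a) (hfg : ∀ a b x y, C b (f a b x) y = B a x (g (e' b) (e a) y))
    (x : ∀ a, P a) (y : ∀ b, Q' b) :
    familyPairing e' C (LinearMap.pi (fun b => ∑ a, f a b ∘ₗ LinearMap.proj a) x) y =
      familyPairing e B x (LinearMap.pi (fun a => ∑ b, g b a ∘ₗ LinearMap.proj b) y) := by
  simp only [familyPairing_apply, LinearMap.pi_apply, LinearMap.sum_apply, LinearMap.comp_apply,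
    LinearMap.proj_apply, map_sum, hfg]
  rw [Finset.sum_comm]
  exact Finset.sum_congr rfl fun a _ =>
    e'.sum_comp fun b => B a (x a) (g b (e a) (y b))

end

/-! ### Complementary smoothings -/

/-- The vertex of the cube opposite to `ε`. -/
def opp {n : ℕ} (ε : Fin n → Bool) : Fin n → Bool := fun j => !ε j

theorem opp_opp {n : ℕ} (ε : Fin n → Bool) : opp (opp ε) = ε :=
  funext fun j => Bool.not_not (ε j)

theorem weight_add_weight_opp {n : ℕ} (ε : Fin n → Bool) : weight ε + weight (opp ε) = n := by
  have h := Finset.card_filter_add_card_filter_not (s := Finset.univ) fun j => ε j = true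
  simpa [weight, opp] using h

theorem isEdge_opp_iff {n : ℕ} {ε ε' : Fin n → Bool} {j : Fin n} :
    IsEdge (opp ε') (opp ε) j ↔ IsEdge ε ε' j := by
  unfold IsEdge opp
  constructor
  · rintro ⟨h1, h2⟩
    have h4 : ε j = false := by simpa using congrFun h2 j
    refine ⟨h4, funext fun i => ?_⟩
    by_cases hi : i = j
    · subst hi; simpa using h1
    · have := congrFun h2 i
      rw [Function.update_of_ne hi] at this ⊢
      simpa using this.symm
  · rintro ⟨h1, rfl⟩
    refine ⟨by simp, funext fun i => ?_⟩
    by_cases hi : i = j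
    · subst hi; simp [h1]
    · simp [Function.update_of_ne hi]

/-- In front of `j` the vertices `ε` and `ε'` agree, so the ones of `opp ε'` there are the zeros of
`ε`. Indices start at `0`, so there are `j` entries in front of the `j`-th. -/
theorem onesBefore_add_onesBefore_opp {n : ℕ} {ε ε' : Fin n → Bool} {j : Fin n}
    (hj : IsEdge ε ε' j) : onesBefore ε j + onesBefore (opp ε') j = j := by
  have h := Finset.card_filter_add_card_filter_not (s := Finset.univ.filter (· < j))
    fun i => ε i = true
  rw [Finset.filter_filter, Finset.filter_filter, Finset.filter_gt_eq_Iio, Fin.card_Iio] at h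
  rw [← h, onesBefore, onesBefore]
  congr 2
  ext i
  simp only [Finset.mem_filter, Finset.mem_univ, true_and, opp, hj.2]
  refine and_congr_right fun hi => ?_
  rw [Function.update_of_ne hi.ne]
  simp

/-- The sign of a vertex in the duality between the cubes of a diagram and of its mirror image. -/
def vertexSign (R : Type*) [CommRing R] {n : ℕ} (ε : Fin n → Bool) : R :=
  ∏ j, if ε j = true then (-1) ^ (j : ℕ) else 1

/-- The sign is its own inverse, so weighting a pairing by it preserves nondegeneracy. -/
theorem vertexSign_mul_self {R : Type*} [CommRing R] {n : ℕ} (ε : Fin n → Bool) :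
    vertexSign R ε * vertexSign R ε = 1 := by
  rw [vertexSign, ← Finset.prod_mul_distrib]
  refine Finset.prod_eq_one fun j _ => ?_
  split_ifs
  · rw [← mul_pow]; simp
  · simp

/-- Only the factor at `j` changes, from `1` to `(-1)^j`. This is exactly the discrepancy between
the signs of an edge and of its opposite, by `onesBefore_add_onesBefore_opp`. -/
theorem vertexSign_of_isEdge {R : Type*} [CommRing R] {n : ℕ} {ε ε' : Fin n → Bool} {j : Fin n}
    (hj : IsEdge ε ε' j) : vertexSign R ε' = (-1) ^ (j : ℕ) * vertexSign R ε := by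
  obtain ⟨h0, rfl⟩ := hj
  rw [vertexSign, vertexSign, ← Finset.mul_prod_erase _ _ (Finset.mem_univ j),
    ← Finset.mul_prod_erase Finset.univ (fun i => if ε i = true then (-1 : R) ^ (i : ℕ) else 1)
      (Finset.mem_univ j), Function.update_self, h0]
  simp only [if_true, Bool.false_eq_true, if_false, one_mul]
  congr 1
  refine Finset.prod_congr rfl fun i hi => ?_
  rw [Function.update_of_ne (Finset.ne_of_mem_erase hi)]

variable {F : Type} [TopologicalSpace F] {S : OrientedSurface F} {n : ℕ}

/-! ### Smoothings and saddles of the mirror diagram -/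

namespace Diagram

/-- A quarter turn exchanges `re²` and `im²`. The two quarter turns differ by `z ↦ -z`, which
preserves every curve, so the sign of the crossing is irrelevant. -/
theorem mem_curve_quarterTurn (b : Bool) (s : ℝ) (z : ℂ) :
    quarterTurn b * z ∈ curve s ↔ z ∈ curve (-s) := by
  cases b
  · rw [← curve_rot, ← curve_neg]
    simp [quarterTurn]
  · exact curve_rot s z

/-- Each crossing is negative in exactly one of the two diagrams. Together with
`weight_add_weight_opp` this makes the degree change sign. -/
theorem negCrossings_add_mirror (D : Diagram S n) :
    D.negCrossings + D.mirror.negCrossings = n := by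
  have h := Finset.card_filter_add_card_filter_not (s := Finset.univ) fun j => D.positive j = false
  simpa [negCrossings, mirror] using h

theorem level_not (b : Bool) : level (!b) = -level b := by
  cases b <;> simp [level]

theorem mirror_chart_mem (D : Diagram S n) (i : Fin n) (s : ℝ) (p : F) :
    (∃ z, p = D.mirror.chart i z ∧ z ∈ curve (-s)) ↔ ∃ z, p = D.chart i z ∧ z ∈ curve s := by
  constructor
  · rintro ⟨z, hp, hz⟩
    exact ⟨_, hp, (mem_curve_quarterTurn _ s z).2 hz⟩
  · rintro ⟨z, hp, hz⟩
    obtain ⟨w, rfl⟩ := (quarterTurnHomeo (D.positive i)).surjective z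
    exact ⟨w, hp, (mem_curve_quarterTurn _ s w).1 hz⟩

theorem range_mirror_chart (D : Diagram S n) (i : Fin n) :
    Set.range (D.mirror.chart i) = Set.range (D.chart i) :=
  range_quarterTurn (D.chart i) (D.positive i)

/-- Changing a crossing and changing the choice of its smoothing cancel: the rotation of the chart
and the passage to the opposite entry both negate the parameter of the curve. -/
theorem mem_mirror_smoothing (D : Diagram S n) (ε : Fin n → Bool) (p : F) :
    p ∈ D.mirror.smoothing (opp ε) ↔ p ∈ D.smoothing ε := by
  simp only [smoothing, Set.mem_ofPred_eq, range_mirror_chart]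
  refine or_congr Iff.rfl (exists_congr fun i => ?_)
  rw [← D.mirror_chart_mem i (level (ε i)), ← level_not]
  rfl

theorem mem_smoothing_of_isEdge (D : Diagram S n) {ε ε' : Fin n → Bool} {j : Fin n}
    (hj : IsEdge ε ε' j) {p : F} (hp : p ∉ Set.range (D.chart j)) :
    p ∈ D.smoothing ε' ↔ p ∈ D.smoothing ε := by
  simp only [smoothing, Set.mem_ofPred_eq]
  refine or_congr Iff.rfl (exists_congr fun i => exists_congr fun z => ?_)
  refine and_congr_right fun hz => ?_
  have hij : i ≠ j := by
    rintro rfl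
    exact hp ⟨z, hz.symm⟩
  rw [hj.2, Function.update_of_ne hij]

/-- Reflecting the interval negates the parameter, `1 - 2(1 - t) = -(1 - 2t)`, and so does the
rotation of the mirror chart. Away from this chart the mirror saddle is a product over `D_ε'`, which
agrees there with `D_ε`. -/
theorem mem_mirror_saddleSet (D : Diagram S n) {ε ε' : Fin n → Bool} {j : Fin n}
    (hj : IsEdge ε ε' j) (p : F) (t : I) :
    (p, σ t) ∈ D.mirror.saddleSet (opp ε') j ↔ (p, t) ∈ D.saddleSet ε j := by
  simp only [saddleSet, Set.mem_ofPred_eq, range_mirror_chart, mem_mirror_smoothing]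
  refine or_congr ?_ ?_
  · exact and_congr_left fun hp => D.mem_smoothing_of_isEdge hj hp
  · rw [← D.mirror_chart_mem j, unitInterval.coe_symm_eq]
    ring_nf

end Diagram

/-! ### Duality between the complexes of a diagram and of its mirror image -/

namespace HQFT

variable [T2Space F] [CompactSpace F] {X : Type*} [TopologicalSpace X] {x₀ : X}
  {D : Diagram S n} {h : C(F, X)}

/-- A smoothing and the opposite smoothing of the mirror diagram are the same subset. -/
def smoothingHomeo (D : Diagram S n) (ε : Fin n → Bool) :
    D.smoothing ε ≃ₜ D.mirror.smoothing (opp ε) :=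
  Homeomorph.setCongr (Set.ext fun p => (D.mem_mirror_smoothing ε p).symm)

/-- A saddle turned upside down is a saddle of the mirror diagram. -/
def saddleHomeo (D : Diagram S n) {ε ε' : Fin n → Bool} {j : Fin n} (hj : IsEdge ε ε' j) :
    D.saddleSet ε j ≃ₜ D.mirror.saddleSet (opp ε') j :=
  ((Homeomorph.refl F).prodCongr ⟨⟨σ, σ, unitInterval.symm_symm, unitInterval.symm_symm⟩,
    unitInterval.continuous_symm, unitInterval.continuous_symm⟩).subtype
      fun x => (D.mem_mirror_saddleSet hj x.1 x.2).symm

section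

variable {R : Type*} [CommRing R] (A : HQFT R X x₀) (b : BasePoints D h x₀)
  (b' : BasePoints D.mirror h x₀)

/-- The pairing between a smoothing and the opposite smoothing of the mirror diagram. -/
def smoothingPairing (ε : Fin n → Bool) :
    A.obj (b.mfd ε) →ₗ[R] A.obj (b'.mfd (opp ε)) →ₗ[R] R :=
  A.pairing (M := b.mfd ε) (M' := b'.mfd (opp ε)) (smoothingHomeo D ε) fun _ => rfl

theorem smoothingPairing_nondegenerate (ε : Fin n → Bool) :
    (A.smoothingPairing b b' ε).Nondegenerate :=
  A.pairing_nondegenerate _ _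

theorem smoothingPairing_saddle {ε ε' : Fin n → Bool} {j : Fin n} (hj : IsEdge ε ε' j)
    (a : A.obj (b.mfd ε)) (c : A.obj (b'.mfd (opp ε'))) :
    A.smoothingPairing b b' ε' (A.τ (b.saddle hj) a) c =
      A.smoothingPairing b b' ε a (A.τ (b'.saddle (isEdge_opp_iff.2 hj)) c) :=
  A.pairing_adjoint (b.saddle hj) (b'.saddle (isEdge_opp_iff.2 hj)) _ _ _ _ (saddleHomeo D hj)
    (fun _ => Subtype.ext (Prod.ext rfl unitInterval.symm_zero))
    (fun _ => Subtype.ext (Prod.ext rfl unitInterval.symm_one)) (fun _ => rfl) a c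

/-- Adjointness with the cube signs included: crossing the edge `j` multiplies `vertexSign` by
`(-1)^j`, which converts the sign of the edge into that of the opposite edge. -/
theorem smoothingPairing_entry (ε ε' : Fin n → Bool)
    (a : A.obj (b.mfd ε)) (c : A.obj (b'.mfd (opp ε'))) :
    vertexSign R ε' * A.smoothingPairing b b' ε' (A.entry b ε ε' a) c =
      vertexSign R ε * A.smoothingPairing b b' ε a (A.entry b' (opp ε') (opp ε) c) := by
  simp only [entry, LinearMap.sum_apply, map_sum, Finset.mul_sum]
  refine Finset.sum_congr rfl fun j _ => ?_
  by_cases hj : IsEdge ε ε' j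
  · rw [dif_pos hj, dif_pos (isEdge_opp_iff.2 hj)]
    simp only [LinearMap.smul_apply, map_smul, smul_eq_mul]
    rw [A.smoothingPairing_saddle b b' hj, vertexSign_of_isEdge hj,
      ← onesBefore_add_onesBefore_opp hj, pow_add]
    have h1 : ((-1 : R) ^ onesBefore ε j) * (-1) ^ onesBefore ε j = 1 := by
      rw [← mul_pow]; simp
    -- The sign `(-1) ^ onesBefore ε j` occurs twice, once from the entry and once from `(-1)^j`,
    -- and cancels; the sign of the opposite edge remains.
    linear_combination ((-1 : R) ^ onesBefore (opp ε') j * vertexSign R ε *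
      A.smoothingPairing b b' ε a (A.τ (b'.saddle (isEdge_opp_iff.2 hj)) c)) * h1
  · rw [dif_neg hj, dif_neg (mt isEdge_opp_iff.1 hj)]
    simp

/-- Passing to the opposite vertex exchanges the degrees `i` and `-i`. -/
def oppIndex (D : Diagram S n) {i i' : ℤ} (hi : i + i' = 0) :
    {ε : Fin n → Bool // (weight ε : ℤ) = i + D.negCrossings} ≃
      {ε : Fin n → Bool // (weight ε : ℤ) = i' + D.mirror.negCrossings} where
  toFun ε := ⟨opp ε.1, by
    have h1 := weight_add_weight_opp ε.1
    have h2 := D.negCrossings_add_mirror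
    have h3 := ε.2
    omega⟩
  invFun ε := ⟨opp ε.1, by
    have h1 := weight_add_weight_opp ε.1
    have h2 := D.negCrossings_add_mirror
    have h3 := ε.2
    omega⟩
  left_inv ε := Subtype.ext (opp_opp ε.1)
  right_inv ε := Subtype.ext (opp_opp ε.1)

/-- The pairing between the complexes of a diagram and of its mirror image. -/
def cochainPairing {i i' : ℤ} (hi : i + i' = 0) :
    A.Cochain b i →ₗ[R] A.Cochain b' i' →ₗ[R] R :=
  familyPairing (oppIndex D hi) fun ε => vertexSign R ε.1 • A.smoothingPairing b b' ε.1

theorem cochainPairing_nondegenerate {i i' : ℤ} (hi : i + i' = 0) :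
    (A.cochainPairing b b' hi).Nondegenerate := by
  refine familyPairing_nondegenerate _ fun ε => ⟨fun a ha => ?_, fun c hc => ?_⟩
  · refine (A.smoothingPairing_nondegenerate b b' ε.1).1 a fun c => ?_
    have h1 : vertexSign R ε.1 * (vertexSign R ε.1 * A.smoothingPairing b b' ε.1 a c) =
        vertexSign R ε.1 * 0 := congrArg (vertexSign R ε.1 * ·) (ha c)
    rwa [← mul_assoc, vertexSign_mul_self, one_mul, mul_zero] at h1
  · refine (A.smoothingPairing_nondegenerate b b' ε.1).2 c fun a => ?_
    have h1 : vertexSign R ε.1 * (vertexSign R ε.1 * A.smoothingPairing b b' ε.1 a c) =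
        vertexSign R ε.1 * 0 := congrArg (vertexSign R ε.1 * ·) (hc a)
    rwa [← mul_assoc, vertexSign_mul_self, one_mul, mul_zero] at h1

/-- The differentials of a diagram and of its mirror image are adjoint. -/
theorem cochainPairing_d {i i' j j' : ℤ} (hi : i + i' = 0) (hj : j + j' = 0)
    (x : A.Cochain b i) (y : A.Cochain b' j') :
    A.cochainPairing b b' hj (A.d b i j x) y = A.cochainPairing b b' hi x (A.d b' j' i' y) :=
  familyPairing_adjoint (oppIndex D hi) (oppIndex D hj) _ _
    (fun ε ε' => A.entry b ε.1 ε'.1) (fun δ' δ => A.entry b' δ'.1 δ.1)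
    (fun ε ε' a c => A.smoothingPairing_entry b b' ε.1 ε'.1 a c) x y

end

end HQFT

end LinkHQFT

end

open LinkHQFT
theorem mainTheorem6 {k : Type*} [Field k]
    {F : Type} [TopologicalSpace F] [T2Space F] [CompactSpace F] (S : OrientedSurface F)
    {n : ℕ} (D : Diagram S n)
    {X : Type*} [TopologicalSpace X] {x₀ : X}
    (K : EilenbergMacLaneOne X x₀ (Multiplicative (H1 F)))
    (h : C(F, X)) (hh : RealizesLabels K h)
    (A : HQFT k X x₀) (hA : A.RespectsSTTu)
    (b : BasePoints D h x₀) (b' : BasePoints D.mirror h x₀) (i : ℤ) :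
    Nonempty (A.Homology b i ≃ₗ[k] A.Homology b' (-i)) := by
  have hfin : ∀ j, FiniteDimensional k (A.Cochain b j) := fun j =>
    haveI := fun ε : {ε : Fin n → Bool // (weight ε : ℤ) = j + D.negCrossings} =>
      A.finite (b.mfd ε.1)
    inferInstance
  -- The degrees are written as in `Homology` at `i` and `-i`: the differential into degree `i` is
  -- adjoint to the one leaving `-i`, and the one leaving `i` to the one entering `-i`.
  have h₀ : (i - 1) + (-i + 1) = 0 := by ring
  have h₁ : i + -i = 0 := by ring
  have h₂ : (i + 1) + (-i - 1) = 0 := by ring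
  exact nonempty_homology_equiv_of_pairing (A.cochainPairing_nondegenerate b b' h₀)
    (A.cochainPairing_nondegenerate b b' h₁) (A.cochainPairing_nondegenerate b b' h₂)
    _ _ _ _ (A.cochainPairing_d b b' h₀ h₁) (A.cochainPairing_d b b' h₁ h₂)
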